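/- All graphs are finite and simple. A graph is three-connected if it has more than three vertices and remains connected after deleting any set of at most two vertices. Let $G$ be a 3-regular, three-connected, planar graph. Then there are an integer $n\ge 0$ and graphs $G=H_0,H_1,\dots,H_n\cong K_4$, each of which is simple, 3-regular, three-connected and planar, such that for every $i<n$ the graph $H_{i+1}$ is isomorphic to a graph obtained from $H_i$ by one of the following two operations. (1) $\Delta Y$ operation: for a triangular face $abc$ of a planar embedding of $H_i$, the edges $ab,bc,ca$ are deleted, a new vertex $y$ adjacent to $a,b,c$ is added, and the vertices $a,b,c$ (which now have valence two) are suppressed by contracting, for each of them, the edge to its neighbour outside the triangle. In other words, $a,b,c$ are replaced by the single vertex $y$, which is joined to the vertices outside the triangle that are adjacent to $a$, $b$ or $c$. (2) Contraction-elongation operation on an edge $v_1v_2$: let $u_1,u_2$ be the other two neighbours of $v_1$ and $u_3,u_4$ the other two neighbours of $v_2$, named so that in a planar embedding of $H_i$ the two faces along $v_1v_2$ have $u_1,v_1,v_2,u_3$ and $u_4,v_2,v_1,u_2$, respectively, as consecutive boundary vertices. The edge $v_1v_2$ is contracted and the resulting 4-valent vertex is elongated to a new edge $w_1w_2$ such that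 $w_1$ is joined to $u_1,u_3$ and $w_2$ is joined to $u_2,u_4$. -/

import Mathlib

universe u

namespace SimpleGraph

variable {V : Type u}

/-- A graph is cubic (3-regular) if every vertex has exactly three neighbours. -/
def IsCubic (G : SimpleGraph V) : Prop :=
  ∀ v : V, (G.neighborSet v).ncard = 3

/-- A (finite) graph is three-connected if it has more than three vertices and stays connected
after the deletion of any set of at most two vertices. -/
def IsThreeConnected (G : SimpleGraph V) : Prop :=
  3 < Nat.card V ∧
    ∀ S : Finset V, S.card < 3 → (G.induce {v : V | v ∉ S}).Connected

/-- A rotation system on a graph: a permutation `rot` of the darts (oriented edges) that cyclically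
permutes the darts leaving each vertex. It describes a cellular embedding of each component of the
graph into an oriented closed surface, `rot` being the cyclic order around the vertices. -/
structure RotationSystem (G : SimpleGraph V) where
  rot : Equiv.Perm G.Dart
  rot_fst : ∀ d : G.Dart, (rot d).fst = d.fst
  rot_cycle : ∀ d d' : G.Dart, d.fst = d'.fst → rot.SameCycle d d'

namespace RotationSystem

variable {G : SimpleGraph V}

/-- The face permutation: the dart `u → v` is followed, along the boundary of the face on a fixed
side of it, by the dart that leaves `v` and comes next after `v → u` in the rotation at `v`. -/
def faceNext (R : G.RotationSystem) : Equiv.Perm G.Dart :=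
  (Dart.symm_involutive (G := G)).toPerm.trans R.rot

/-- The boundary walks of the faces: the cycles of the face permutation. -/
def Face (R : G.RotationSystem) : Type u :=
  Quotient (Equiv.Perm.SameCycle.setoid R.faceNext)

/-- The rotation system of a finite graph is planar if each component is embedded in the sphere:
Euler's formula `#V - #E + #F = 2 #C` holds, where the faces are counted component by component
and an isolated vertex, which has no dart, lies on a face of its own. (Each component satisfies
`#V - #E + #F ≤ 2`, so that equality for the sums means equality for every component.) -/
def IsPlanar (R : G.RotationSystem) : Prop :=
  Nat.card V + (Nat.card R.Face + Nat.card {v : V // ∀ w, ¬ G.Adj v w}) =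
    Nat.card G.edgeSet + 2 * Nat.card G.ConnectedComponent

/-- The darts `u → v` and `v → w` are consecutive on the boundary of a face. -/
def Consecutive (R : G.RotationSystem) (u v w : V) : Prop :=
  ∃ (huv : G.Adj u v) (hvw : G.Adj v w), R.faceNext ⟨(u, v), huv⟩ = ⟨(v, w), hvw⟩

end RotationSystem

/-- A finite graph is planar if it has a planar (combinatorial) embedding. -/
def IsPlanar (G : SimpleGraph V) : Prop :=
  ∃ R : G.RotationSystem, R.IsPlanar

/-- The graph obtained from a cubic graph `G` with a triangle `a b c` by replacing the triangle by
a Y: the edges of the triangle are deleted, a new vertex `none` is joined to `a`, `b`, `c`, and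
then each of `a`, `b`, `c`, which now has valence two, is suppressed by contracting the edge to
its neighbour outside the triangle (multiple edges, if any, become simple). So the new vertex
replaces `a`, `b`, `c` and its neighbours are the remaining vertices adjacent to `a`, `b` or `c`. -/
def deltaY (G : SimpleGraph V) (a b c : V) :
    SimpleGraph (Option {v : V // v ≠ a ∧ v ≠ b ∧ v ≠ c}) where
  Adj
    | some x, some y => G.Adj x y
    | some x, none => G.Adj x a ∨ G.Adj x b ∨ G.Adj x c
    | none, some y => G.Adj y a ∨ G.Adj y b ∨ G.Adj y c
    | none, none => False
  symm := by
    constructor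
    rintro (_ | x) (_ | y) h
    · exact h
    · exact h
    · exact h
    · exact G.adj_symm h
  loopless := by
    constructor
    rintro (_ | x) h
    · exact h
    · exact G.irrefl h

/-- `G'` arises from the cubic planar graph `G` by a ΔY transformation: a triangular face `a b c`
of a planar embedding of `G` is replaced by a Y. -/
def IsDeltaY {W : Type u} (G : SimpleGraph V) (G' : SimpleGraph W) : Prop :=
  ∃ R : G.RotationSystem, R.IsPlanar ∧ ∃ a b c : V,
    R.Consecutive a b c ∧ R.Consecutive b c a ∧ R.Consecutive c a b ∧
    Nonempty (G' ≃g G.deltaY a b c)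

/-- Let `v₁ v₂` be an edge, let `u₁, u₂` be the other neighbours of `v₁` and `u₃, u₄` those of
`v₂`. Contract `v₁ v₂` to a vertex with neighbours `u₁, u₂, u₃, u₄` and elongate this vertex to a
new edge `w₁ w₂`, with `w₁` joined to `u₁, u₃` and `w₂` joined to `u₂, u₄`. Here `w₁, w₂` are
again called `v₁, v₂`, so that only the edges `v₁ u₂` and `v₂ u₃` change. -/
def contractElongate (G : SimpleGraph V) (v₁ v₂ u₂ u₃ : V) : SimpleGraph V :=
  G.deleteEdges {s(v₁, u₂), s(v₂, u₃)} ⊔ fromEdgeSet {s(v₁, u₃), s(v₂, u₂)}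

/-- `G'` arises from the cubic planar graph `G` by a contraction-elongation operation on an edge
`v₁ v₂`. In a planar embedding of `G`, one of the two faces along this edge has `u₁, v₁, v₂, u₃`
as consecutive boundary vertices and the other one has `u₄, v₂, v₁, u₂`. The new edge separates
the other two faces at `v₁` and `v₂`: its ends are joined to `u₁, u₃` and to `u₂, u₄`. -/
def IsContractionElongation {W : Type u} (G : SimpleGraph V) (G' : SimpleGraph W) : Prop :=
  ∃ R : G.RotationSystem, R.IsPlanar ∧ ∃ v₁ v₂ u₁ u₂ u₃ u₄ : V,
    R.Consecutive u₁ v₁ v₂ ∧ R.Consecutive v₁ v₂ u₃ ∧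
    R.Consecutive u₄ v₂ v₁ ∧ R.Consecutive v₂ v₁ u₂ ∧
    Nonempty (G' ≃g G.contractElongate v₁ v₂ u₂ u₃)

end SimpleGraph

/-! The strategy is to shrink a face until it is a triangle and then to remove the triangle. Let x₀,
x₁, x₂, … be the boundary of a face of length k ≥ 4. Contraction-elongation on x₁x₂ pushes this edge
off the boundary, leaving a face x₀, x₁, x₃, … of length k - 1 on the same vertex set
(`IsFaceWalk.exists_shorter`). A triangular face is removed by ΔY, which lowers the number of
vertices. Lexicographic induction on (number of vertices, length of a chosen face) ends at four
vertices, where a cubic graph is K₄ (`IsPlanarCubicMap.isReducible_of_period`).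

The operations have to stay within the class. With more than four vertices, the three outer
neighbours of a triangle are distinct, and ΔY is the contraction of the triangle; cuts and cochains
of the result pull back to `G`. Contraction-elongation may destroy three-connectivity, but only if
some three-edge cut contains x₀x₁ and x₂x₃ and has x₁, x₂ and their neighbours off the face on one
side (`exists_isObstructingCut`). By uncrossing, such cuts cannot exist for both x₁x₂ and x₂x₃
(`not_isObstructingCut_and`), so one of two consecutive edges is always usable.

Two translations make this manageable. For finite nonempty cubic graphs, three-connectivity is the
same as three-edge-connectivity. For connected graphs without isolated vertices, Euler's formula
says that the first cohomology mod 2 of the embedded surface vanishes (`isPlanar_iff_isAcyclic`);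
this can be carried through local changes without counting faces. It also replaces the Jordan curve
theorem: a face running along an edge in both directions would make that edge a bridge
(`not_reverse_zero`), so faces are bounded by simple cycles. -/

namespace SimpleGraph

/-! ### Planarity of rotation systems and cohomology with coefficients in `ZMod 2` -/

section LinearAlgebra

theorem finrank_ker_comp {K L M N : Type*} [Field K] [AddCommGroup L] [Module K L]
    [AddCommGroup M] [Module K M] [AddCommGroup N] [Module K N] [FiniteDimensional K L]
    (f : M →ₗ[K] N) (g : L →ₗ[K] M) :
    Module.finrank K (LinearMap.ker (f ∘ₗ g)) =
      Module.finrank K (LinearMap.ker g) +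
        Module.finrank K (LinearMap.range g ⊓ LinearMap.ker f : Submodule K M) := by
  have h := LinearMap.finrank_range_add_finrank_ker (g.domRestrict (LinearMap.ker (f ∘ₗ g)))
  have h1 : LinearMap.range (g.domRestrict (LinearMap.ker (f ∘ₗ g))) =
      LinearMap.range g ⊓ LinearMap.ker f := by
    ext x
    simp only [LinearMap.mem_range, Submodule.mem_inf, LinearMap.mem_ker]
    constructor
    · rintro ⟨⟨y, hy⟩, rfl⟩
      exact ⟨⟨y, rfl⟩, hy⟩
    · rintro ⟨⟨y, rfl⟩, hy⟩
      exact ⟨⟨y, hy⟩, rfl⟩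
  have h2 : LinearMap.ker (g.domRestrict (LinearMap.ker (f ∘ₗ g))) =
      (LinearMap.ker g).comap (LinearMap.ker (f ∘ₗ g)).subtype := by
    ext x
    simp
  have h3 : LinearMap.ker g ≤ LinearMap.ker (f ∘ₗ g) := fun x hx => by
    simp only [LinearMap.mem_ker, LinearMap.comp_apply] at hx ⊢
    rw [hx, map_zero]
  rw [h1, h2, (Submodule.comapSubtypeEquivOfLe h3).finrank_eq] at h
  omega

theorem finrank_ker_mulVecLin_transpose {K D : Type*} [Field K] [Fintype D] [DecidableEq D]
    (A : Matrix D D K) :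
    Module.finrank K (LinearMap.ker A.transpose.mulVecLin) =
      Module.finrank K (LinearMap.ker A.mulVecLin) := by
  have h1 := LinearMap.finrank_range_add_finrank_ker A.mulVecLin
  have h2 := LinearMap.finrank_range_add_finrank_ker A.transpose.mulVecLin
  have h3 := A.rank_transpose
  unfold Matrix.rank at h3
  omega

theorem finrank_eq_card_of_factors {K D Q : Type*} [Field K] [Finite D] {q : D → Q}
    (hq : Function.Surjective q) {p : Submodule K (D → K)}
    (hp : ∀ h, h ∈ p ↔ ∃ k : Q → K, h = k ∘ q) : Module.finrank K p = Nat.card Q := by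
  have : Finite Q := Finite.of_surjective q hq
  have := Fintype.ofFinite Q
  have h1 : LinearMap.range (LinearMap.funLeft K K q) = p := by
    ext h
    rw [hp]
    simp only [LinearMap.mem_range]
    exact ⟨fun ⟨k, hk⟩ => ⟨k, hk.symm⟩, fun ⟨k, hk⟩ => ⟨k, hk.symm⟩⟩
  rw [← h1, LinearMap.finrank_range_of_inj (LinearMap.funLeft_injective_of_surjective K K q hq),
    Module.finrank_fintype_fun_eq_card, Nat.card_eq_fintype_card]

theorem _root_.Equiv.Perm.SameCycle.apply_eq {D K : Type*} {σ : Equiv.Perm D} {h : D → K}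
    (hσ : ∀ d, h (σ d) = h d) {x y : D} (hxy : σ.SameCycle x y) : h x = h y := by
  obtain ⟨i, rfl⟩ := hxy
  induction i using Int.induction_on with
  | zero => simp
  | succ n ih => rw [add_comm, zpow_add, zpow_one, Equiv.Perm.mul_apply, hσ, ih]
  | pred n ih =>
    rw [ih, ← hσ ((σ ^ (-(n : ℤ) - 1)) x), ← Equiv.Perm.mul_apply, ← zpow_one_add]
    congr 3
    ring

/-- The matrix of `h ↦ h + h ∘ σ` over `ZMod 2`. -/
def coboundaryMatrix {D : Type*} [DecidableEq D] (σ : Equiv.Perm D) : Matrix D D (ZMod 2) :=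
  1 + σ.permMatrix (ZMod 2)

theorem coboundaryMatrix_apply {D : Type*} [Fintype D] [DecidableEq D] (σ : Equiv.Perm D)
    (h : D → ZMod 2) (d : D) : (coboundaryMatrix σ).mulVecLin h d = h d + h (σ d) := by
  simp [coboundaryMatrix, Matrix.permMatrix_mulVec]

theorem mem_ker_coboundaryMatrix {D : Type*} [Fintype D] [DecidableEq D] (σ : Equiv.Perm D)
    (h : D → ZMod 2) :
    h ∈ LinearMap.ker (coboundaryMatrix σ).mulVecLin ↔ ∀ d, h (σ d) = h d := by
  rw [LinearMap.mem_ker, funext_iff]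
  simp only [coboundaryMatrix_apply, Pi.zero_apply, CharTwo.add_eq_zero]
  exact forall_congr' fun d => eq_comm

theorem transpose_coboundaryMatrix {D : Type*} [DecidableEq D] (σ : Equiv.Perm D) :
    (coboundaryMatrix σ).transpose = coboundaryMatrix σ⁻¹ := by
  simp [coboundaryMatrix, Matrix.transpose_permMatrix]

theorem finrank_ker_coboundaryMatrix {D : Type*} [Fintype D] [DecidableEq D]
    (σ : Equiv.Perm D) :
    Module.finrank (ZMod 2) (LinearMap.ker (coboundaryMatrix σ).mulVecLin) =
      Nat.card (Quotient (Equiv.Perm.SameCycle.setoid σ)) := by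
  refine finrank_eq_card_of_factors (q := Quotient.mk (Equiv.Perm.SameCycle.setoid σ))
    Quotient.mk_surjective fun h => ?_
  rw [mem_ker_coboundaryMatrix]
  constructor
  · intro hσ
    exact ⟨Quotient.lift h fun x y hxy => Equiv.Perm.SameCycle.apply_eq hσ hxy, rfl⟩
  · rintro ⟨k, rfl⟩ d
    refine congrArg k (Quotient.sound ?_)
    exact Equiv.Perm.sameCycle_apply_left.2 (Equiv.Perm.SameCycle.refl _ _)

end LinearAlgebra

/-! ### Euler's formula as vanishing of the first cohomology mod 2 -/

namespace RotationSystem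

variable {V : Type u} {G : SimpleGraph V}

/-- Every cochain with coefficients in `ZMod 2` that vanishes on all faces is the coboundary of a
function on the vertices. That the cochain `M` vanishes on all faces is expressed by a function `h`
with `M d = h d + h (R.faceNext d)`. -/
def IsAcyclic (R : G.RotationSystem) : Prop :=
  ∀ h : G.Dart → ZMod 2,
    (∀ d, h d + h (R.faceNext d) = h d.symm + h (R.faceNext d.symm)) →
    ∃ φ : V → ZMod 2, ∀ d : G.Dart, h d + h (R.faceNext d) = φ d.fst + φ d.snd

/-- On functions on darts, let A = 1 + (face permutation) and S = 1 + (reversal). Edge cochains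
vanishing on all faces form range A ∩ ker S; coboundaries form a subspace of dimension #V - 1. Since
SA and its transpose AᵀS have kernels of equal dimension, #F + dim (range A ∩ ker S) = #E + dim
(range S ∩ ker Aᵀ) = #E + 1. The two spaces therefore differ in dimension by 2 - (#V - #E + #F). -/
theorem isPlanar_iff_isAcyclic [Finite V] (R : G.RotationSystem) (hG : G.Connected)
    (hd : ∀ v, ∃ w, G.Adj v w) : R.IsPlanar ↔ R.IsAcyclic := by
  classical
  have := Fintype.ofFinite V
  have hne := hG.nonempty
  set A := coboundaryMatrix R.faceNext with hA
  let α : Equiv.Perm G.Dart := (Dart.symm_involutive (G := G)).toPerm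
  have hα : ∀ d, α d = d.symm := fun _ => rfl
  have hαinv : α⁻¹ = α := by
    ext1 d
    rw [Equiv.Perm.inv_eq_iff_eq, hα, hα, Dart.symm_symm]
  set S := coboundaryMatrix α with hS
  have hST : S.transpose = S := by rw [hS, transpose_coboundaryMatrix, hαinv]
  have e1 := finrank_ker_comp S.mulVecLin A.mulVecLin
  have e2 := finrank_ker_comp A.transpose.mulVecLin S.mulVecLin
  have e3 := finrank_ker_mulVecLin_transpose (S * A)
  rw [Matrix.transpose_mul, hST, Matrix.mulVecLin_mul, Matrix.mulVecLin_mul] at e3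
  have eF : Module.finrank (ZMod 2) (LinearMap.ker A.mulVecLin) = Nat.card R.Face :=
    finrank_ker_coboundaryMatrix _
  have eE : Module.finrank (ZMod 2) (LinearMap.ker S.mulVecLin) = Nat.card G.edgeSet := by
    refine finrank_eq_card_of_factors (q := fun d : G.Dart => (⟨d.edge, d.edge_mem⟩ : G.edgeSet))
      ?_ fun h => ?_
    · rintro ⟨e, he⟩
      induction e with
      | _ x y => exact ⟨⟨(x, y), he⟩, rfl⟩
    · rw [mem_ker_coboundaryMatrix]
      constructor
      · intro hs
        have hsur : ∀ e : G.edgeSet, ∃ d : G.Dart, d.edge = e := by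
          rintro ⟨e, he⟩
          induction e with
          | _ x y => exact ⟨⟨(x, y), he⟩, rfl⟩
        choose s hs' using hsur
        refine ⟨fun e => h (s e), funext fun d => ?_⟩
        rcases (dart_edge_eq_iff _ _).1 (hs' ⟨d.edge, d.edge_mem⟩) with h1 | h1
        · simp [h1]
        · have := hs d
          rw [hα] at this
          simp [h1, this]
      · rintro ⟨k, rfl⟩ d
        simp [hα]
  -- A function invariant under reversal and under the face permutation is invariant under `rot`, so
  -- it depends only on the tail of a dart and, by connectedness, is constant.
  have eI : Module.finrank (ZMod 2)
      (LinearMap.range S.mulVecLin ⊓ LinearMap.ker A.transpose.mulVecLin :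
        Submodule (ZMod 2) (G.Dart → ZMod 2)) = 1 := by
    have hdart : Nonempty G.Dart := by
      obtain ⟨w, hw⟩ := hd hne.some
      exact ⟨⟨(_, w), hw⟩⟩
    have hone : ∀ p : Submodule (ZMod 2) (G.Dart → ZMod 2), p =
        LinearMap.range S.mulVecLin ⊓ LinearMap.ker A.transpose.mulVecLin →
        Module.finrank (ZMod 2) p = Nat.card Unit := by
      rintro p rfl
      refine finrank_eq_card_of_factors (q := fun _ : G.Dart => ())
        (fun _ => ⟨hdart.some, rfl⟩) fun h => ?_
      rw [Submodule.mem_inf, hA, transpose_coboundaryMatrix, mem_ker_coboundaryMatrix]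
      constructor
      · rintro ⟨⟨g, rfl⟩, hker⟩
        set h := S.mulVecLin g with hh
        have hsymm : ∀ d : G.Dart, h d.symm = h d := fun d => by
          rw [hh, hS, coboundaryMatrix_apply, coboundaryMatrix_apply, hα, hα, Dart.symm_symm,
            add_comm]
        have hnext : ∀ d, h (R.faceNext d) = h d := fun d => by
          have := hker (R.faceNext d)
          change h (R.faceNext.symm (R.faceNext d)) = _ at this
          rw [Equiv.symm_apply_apply] at this
          exact this.symm
        have hrot : ∀ d, h (R.rot d) = h d := fun d => by
          have := hnext d.symm
          rw [hsymm] at this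
          rw [← this]
          simp [faceNext, Equiv.trans_apply]
        have hfst : ∀ d d' : G.Dart, d.fst = d'.fst → h d = h d' := fun d d' hdd =>
          Equiv.Perm.SameCycle.apply_eq hrot (R.rot_cycle d d' hdd)
        choose nb hnb using hd
        let k : V → ZMod 2 := fun v => h ⟨(v, nb v), hnb v⟩
        have hk : ∀ d : G.Dart, h d = k d.fst := fun d => hfst _ _ rfl
        have hk2 : ∀ v w, G.Adj v w → k v = k w := fun v w hvw => by
          rw [← hk ⟨(v, w), hvw⟩, ← hsymm]
          exact hk ⟨(w, v), hvw.symm⟩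
        have hk3 : ∀ v w, k v = k w := fun v w => by
          obtain ⟨p⟩ := hG.preconnected v w
          induction p with
          | nil => rfl
          | cons hadj _ ih => exact (hk2 _ _ hadj).trans ih
        exact ⟨fun _ => k hne.some, funext fun d => (hk d).trans (hk3 _ _)⟩
      · rintro ⟨k, rfl⟩
        refine ⟨?_, fun d => rfl⟩
        let e := Fintype.equivFin V
        -- Numbering the vertices orients every edge. Exactly one dart of each edge is increasing,
        -- so S sends the multiple of its indicator to a constant.
        refine ⟨fun d => if e d.fst < e d.snd then k () else 0, funext fun d => ?_⟩
        rw [hS, coboundaryMatrix_apply, hα]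
        have hne : e d.fst ≠ e d.snd := fun h => d.fst_ne_snd (e.injective h)
        rcases lt_or_gt_of_ne hne with h1 | h1
        · simp [h1, h1.le, not_lt]
        · simp [h1, h1.le, not_lt]
    rw [hone _ rfl, Nat.card_unique]
  let δ : (V → ZMod 2) →ₗ[ZMod 2] (G.Dart → ZMod 2) :=
    LinearMap.funLeft (ZMod 2) (ZMod 2) (fun d : G.Dart => d.fst) +
      LinearMap.funLeft (ZMod 2) (ZMod 2) (fun d : G.Dart => d.snd)
  have hδ : ∀ φ d, δ φ d = φ d.fst + φ d.snd := fun _ _ => rfl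
  have eδ := LinearMap.finrank_range_add_finrank_ker δ
  have ekδ : Module.finrank (ZMod 2) (LinearMap.ker δ) = Nat.card Unit := by
    refine finrank_eq_card_of_factors (q := fun _ : V => ()) (fun _ => ⟨hne.some, rfl⟩) fun φ => ?_
    constructor
    · intro hφ
      have h2 : ∀ v w, G.Adj v w → φ v = φ w := fun v w hvw => by
        have := congrFun hφ ⟨(v, w), hvw⟩
        rw [hδ] at this
        exact CharTwo.add_eq_zero.1 this
      have h3 : ∀ v w, φ v = φ w := fun v w => by
        obtain ⟨p⟩ := hG.preconnected v w
        induction p with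
        | nil => rfl
        | cons hadj _ ih => exact (h2 _ _ hadj).trans ih
      exact ⟨fun _ => φ hne.some, funext fun v => h3 _ _⟩
    · rintro ⟨k, rfl⟩
      refine funext fun d => ?_
      rw [hδ]
      exact CharTwo.add_self_eq_zero _
  rw [ekδ, Nat.card_unique, Module.finrank_fintype_fun_eq_card, ← Nat.card_eq_fintype_card] at eδ
  have hle : LinearMap.range δ ≤ LinearMap.range A.mulVecLin ⊓ LinearMap.ker S.mulVecLin := by
    rintro _ ⟨φ, rfl⟩
    refine ⟨⟨fun d => φ d.fst, funext fun d => ?_⟩, ?_⟩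
    · rw [hA, coboundaryMatrix_apply, hδ]
      congr 2
      simp [faceNext, Equiv.trans_apply, R.rot_fst]
    · rw [SetLike.mem_coe, mem_ker_coboundaryMatrix]
      intro d
      rw [hα, hδ, hδ, add_comm]
      rfl
  have hC : Nat.card G.ConnectedComponent = 1 := by
    have := hG.preconnected.subsingleton_connectedComponent
    have : Nonempty G.ConnectedComponent := ⟨G.connectedComponentMk hne.some⟩
    exact Nat.card_unique
  have hiso : Nat.card {v : V // ∀ w, ¬ G.Adj v w} = 0 := by
    have : IsEmpty {v : V // ∀ w, ¬ G.Adj v w} :=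
      ⟨fun ⟨v, hv⟩ => (hd v).elim fun w hw => hv w hw⟩
    exact Nat.card_of_isEmpty
  have key : R.IsPlanar ↔ Module.finrank (ZMod 2) (LinearMap.range δ) = Module.finrank (ZMod 2)
      (LinearMap.range A.mulVecLin ⊓ LinearMap.ker S.mulVecLin :
        Submodule (ZMod 2) (G.Dart → ZMod 2)) := by
    unfold IsPlanar
    rw [hC, hiso]
    omega
  rw [key]
  constructor
  · intro heq h hh
    have := Submodule.eq_of_le_of_finrank_eq hle heq
    have hmem : A.mulVecLin h ∈ LinearMap.range δ := by
      rw [this]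
      refine ⟨⟨h, rfl⟩, ?_⟩
      rw [SetLike.mem_coe, mem_ker_coboundaryMatrix]
      intro d
      rw [hA, coboundaryMatrix_apply, coboundaryMatrix_apply, hα, hh d]
    obtain ⟨φ, hφ⟩ := hmem
    refine ⟨φ, fun d => ?_⟩
    rw [← hδ, hφ, hA, coboundaryMatrix_apply]
  · intro hac
    suffices heq : LinearMap.range δ = LinearMap.range A.mulVecLin ⊓ LinearMap.ker S.mulVecLin by
      rw [heq]
    refine le_antisymm hle ?_
    rintro _ ⟨⟨h, rfl⟩, hs⟩
    rw [SetLike.mem_coe, mem_ker_coboundaryMatrix] at hs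
    obtain ⟨φ, hφ⟩ := hac h fun d => by
      have := hs d
      rw [hA, coboundaryMatrix_apply, coboundaryMatrix_apply, hα] at this
      exact this.symm
    refine ⟨φ, funext fun d => ?_⟩
    rw [hδ, ← hφ, hA, coboundaryMatrix_apply]

end RotationSystem

end SimpleGraph

namespace SimpleGraph

variable {V : Type u} {G : SimpleGraph V}

/-! ### Edge connectivity of cubic graphs -/

/-- A graph is three-edge-connected if any two edges fail to separate it. -/
def IsThreeEdgeConnected (G : SimpleGraph V) : Prop :=
  ∀ (S : Set V) (e₁ e₂ : Sym2 V),
    (∀ a ∈ S, ∀ b ∉ S, G.Adj a b → s(a, b) = e₁ ∨ s(a, b) = e₂) → S = ∅ ∨ S = Set.univ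

theorem IsThreeEdgeConnected.false (hG : G.IsThreeEdgeConnected) {S : Set V} {x y : V}
    (e₁ e₂ : Sym2 V) (hx : x ∈ S) (hy : y ∉ S)
    (h : ∀ a ∈ S, ∀ b ∉ S, G.Adj a b → s(a, b) = e₁ ∨ s(a, b) = e₂) : False := by
  rcases hG S e₁ e₂ h with rfl | rfl
  · exact hx
  · exact hy trivial

theorem IsCubic.exists_neighbors (hG : G.IsCubic) (v : V) :
    ∃ p q r, p ≠ q ∧ p ≠ r ∧ q ≠ r ∧ ∀ w, G.Adj v w ↔ w = p ∨ w = q ∨ w = r := by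
  obtain ⟨p, q, r, h1, h2, h3, h⟩ := Set.ncard_eq_three.1 (hG v)
  refine ⟨p, q, r, h1, h2, h3, fun w => ?_⟩
  rw [← mem_neighborSet, h]
  simp

theorem isCubic_of_neighbors (h : ∀ v, ∃ p q r, p ≠ q ∧ p ≠ r ∧ q ≠ r ∧
    ∀ w, G.Adj v w ↔ w = p ∨ w = q ∨ w = r) : G.IsCubic := by
  intro v
  obtain ⟨p, q, r, h1, h2, h3, h⟩ := h v
  refine Set.ncard_eq_three.2 ⟨p, q, r, h1, h2, h3, ?_⟩
  ext w
  simp [h]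

/-- Deleting the ends p, q in `S` of the two edges would separate any further vertex of `S` from the
complement. If `S` is contained in {p, q}, each of its vertices has at most one neighbour in `S`, so
two of its edges leave `S` and must be e₁ and e₂. This forces p = q, and then three edges leave `S`.
-/
theorem IsThreeConnected.isThreeEdgeConnected (hG : G.IsThreeConnected) (hc : G.IsCubic) :
    G.IsThreeEdgeConnected := by
  classical
  intro S e₁ e₂ hS
  by_contra! hcon
  obtain ⟨⟨a₀, ha₀⟩, hun⟩ := hcon
  obtain ⟨b₀, hb₀⟩ := (Set.ne_univ_iff_exists_notMem S).1 hun
  have hpick : ∀ e : Sym2 V, ∃ p ∈ S, ∀ a ∈ S, ∀ b ∉ S, s(a, b) = e → a = p := by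
    intro e
    by_cases h : ∃ a ∈ S, ∃ b ∉ S, s(a, b) = e
    · obtain ⟨p, hp, q, hq, rfl⟩ := h
      refine ⟨p, hp, fun a ha b hb hab => ?_⟩
      rcases Sym2.eq_iff.1 hab with h | h
      · exact h.1
      · exact absurd (h.1 ▸ ha) hq
    · exact ⟨a₀, ha₀, fun a ha b hb hab => absurd ⟨a, ha, b, hb, hab⟩ h⟩
  obtain ⟨p, hp, hp'⟩ := hpick e₁
  obtain ⟨q, hq, hq'⟩ := hpick e₂
  by_cases hex : ∃ a ∈ S, a ≠ p ∧ a ≠ q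
  · obtain ⟨a, ha, hap, haq⟩ := hex
    have hconn := hG.2 {p, q} (lt_of_le_of_lt Finset.card_le_two (by norm_num))
    have hbp : b₀ ≠ p := fun h => hb₀ (h ▸ hp)
    have hbq : b₀ ≠ q := fun h => hb₀ (h ▸ hq)
    obtain ⟨w⟩ := hconn.preconnected ⟨a, by simp [hap, haq]⟩ ⟨b₀, by simp [hbp, hbq]⟩
    obtain ⟨d, -, h1, h2⟩ := w.exists_boundary_dart {v | (v : V) ∈ S} ha hb₀
    have hadj : G.Adj d.fst d.snd := d.adj
    have h3 := d.fst.2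
    simp only [Finset.mem_insert, Finset.mem_singleton, not_or, Set.mem_ofPred_eq] at h3
    rcases hS _ h1 _ h2 hadj with h | h
    · exact h3.1 (hp' _ h1 _ h2 h)
    · exact h3.2 (hq' _ h1 _ h2 h)
  · push Not at hex
    have hnb : ∀ a ∈ S, ∃ b ∉ S, s(a, b) = e₁ := by
      intro a ha
      obtain ⟨x, y, z, hxy, hxz, hyz, hadj⟩ := hc.exists_neighbors a
      have hx := (hadj x).2 (by simp)
      have hy := (hadj y).2 (by simp)
      have hz := (hadj z).2 (by simp)
      have hin : ∀ u v, u ≠ v → G.Adj a u → G.Adj a v → u ∈ S → v ∉ S := by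
        intro u v huv hau hav hu hv
        rcases or_iff_not_imp_left.2 (hex a ha) with h1 | h1 <;>
        rcases or_iff_not_imp_left.2 (hex u hu) with h2 | h2 <;>
        rcases or_iff_not_imp_left.2 (hex v hv) with h3 | h3 <;>
        first
        | exact huv (h2.trans h3.symm)
        | exact hau.ne (h1.trans h2.symm)
        | exact hav.ne (h1.trans h3.symm)
      by_contra! hno
      have hout : ∀ u, G.Adj a u → u ∉ S → s(a, u) = e₂ := fun u hau hu =>
        (hS a ha u hu hau).resolve_left (hno u hu)
      have hin' : ∀ u v, u ≠ v → G.Adj a u → G.Adj a v → u ∉ S → v ∈ S := by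
        intro u v huv hau hav hu
        by_contra hv
        exact huv (Sym2.congr_right.1 ((hout u hau hu).trans (hout v hav hv).symm))
      have k1 := hin' x y hxy hx hy
      have k2 := hin' x z hxz hx hz
      have k3 := hin' y z hyz hy hz
      have k4 := hin x y hxy hx hy
      have k5 := hin x z hxz hx hz
      have k6 := hin y z hyz hy hz
      tauto
    obtain ⟨b, hb, hpb⟩ := hnb p hp
    have hpq : p = q := by
      obtain ⟨c, hc, hqc⟩ := hnb q hq
      exact (hp' q hq c hc hqc).symm
    subst hpq
    obtain ⟨x, y, z, hxy, hxz, hyz, hadj⟩ := hc.exists_neighbors p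
    have hout : ∀ u, G.Adj p u → u ∉ S := fun u hu huS => hu.ne (by
      by_contra hne
      exact hne (hex u huS (Ne.symm hne)).symm)
    have hx := (hadj x).2 (by simp)
    have hy := (hadj y).2 (by simp)
    have hz := (hadj z).2 (by simp)
    rcases hS p hp x (hout x hx) hx with h1 | h1 <;>
    rcases hS p hp y (hout y hy) hy with h2 | h2 <;>
    rcases hS p hp z (hout z hz) hz with h3 | h3 <;>
    first
    | exact hxy (Sym2.congr_right.1 (h1.trans h2.symm))
    | exact hxz (Sym2.congr_right.1 (h1.trans h3.symm))
    | exact hyz (Sym2.congr_right.1 (h2.trans h3.symm))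

theorem IsCubic.three_lt_card [Finite V] (hc : G.IsCubic) (v : V) : 3 < Nat.card V := by
  classical
  have := Fintype.ofFinite V
  obtain ⟨x, y, z, hxy, hxz, hyz, hadj⟩ := hc.exists_neighbors v
  have h1 := ((hadj x).2 (by simp)).ne
  have h2 := ((hadj y).2 (by simp)).ne
  have h3 := ((hadj z).2 (by simp)).ne
  have : ({v, x, y, z} : Finset V).card = 4 := by
    rw [Finset.card_insert_of_notMem (by simp [h1, h2, h3]),
      Finset.card_eq_three.2 ⟨x, y, z, hxy, hxz, hyz, rfl⟩]
  rw [Nat.card_eq_fintype_card]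
  have := Finset.card_le_univ ({v, x, y, z} : Finset V)
  omega

/-- A separating set of at most two vertices is turned into a cut of at most two edges: at a cubic
vertex, one of the two sides receives at most one edge, and the vertex is moved to the opposite
side. -/
theorem IsThreeEdgeConnected.isThreeConnected [Finite V] (hG : G.IsThreeEdgeConnected)
    (hc : G.IsCubic) (v₀ : V) : G.IsThreeConnected := by
  classical
  have hcard := hc.three_lt_card v₀
  refine ⟨hcard, fun S hS => ?_⟩
  obtain ⟨s, t, hst⟩ : ∃ s t, ∀ v ∈ S, v = s ∨ v = t := by
    obtain h | h | h : S.card = 0 ∨ S.card = 1 ∨ S.card = 2 := by omega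
    · rw [Finset.card_eq_zero] at h
      exact ⟨v₀, v₀, by simp [h]⟩
    · obtain ⟨a, rfl⟩ := Finset.card_eq_one.1 h
      exact ⟨a, a, by simp⟩
    · obtain ⟨a, b, -, rfl⟩ := Finset.card_eq_two.1 h
      exact ⟨a, b, by simp⟩
  have hne : Nonempty {v : V | v ∉ S} := by
    by_contra hemp
    have hall : ∀ v, v ∈ S := fun v => by
      by_contra hv
      exact hemp ⟨⟨v, hv⟩⟩
    have := Fintype.ofFinite V
    rw [Nat.card_eq_fintype_card, ← Finset.card_univ, ← Finset.eq_univ_of_forall hall] at hcard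
    omega
  refine ⟨fun x y => ?_⟩
  by_contra hxy
  let A : Set V := {v | ∃ h : v ∉ S, (G.induce {v : V | v ∉ S}).Reachable x ⟨v, h⟩}
  have hA : ∀ a ∈ A, ∀ b ∉ S, G.Adj a b → b ∈ A := by
    rintro a ⟨ha, hxa⟩ b hb hab
    refine ⟨hb, hxa.trans (Adj.reachable ?_)⟩
    exact hab
  let Q : V → Prop := fun v => ∃ e : Sym2 V, ∀ b ∉ A, G.Adj v b → s(v, b) = e
  have he : ∀ v, ∃ e : Sym2 V, (Q v → ∀ b ∉ A, G.Adj v b → s(v, b) = e) ∧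
      (¬ Q v → ∀ a ∈ A, G.Adj v a → s(a, v) = e) := by
    intro v
    by_cases hQ : Q v
    · obtain ⟨e, he⟩ := id hQ
      exact ⟨e, fun _ => he, fun h => absurd hQ h⟩
    · obtain ⟨p, q, r, -, -, -, hadj⟩ := hc.exists_neighbors v
      suffices h : ∃ e : Sym2 V, ∀ a ∈ A, G.Adj v a → s(a, v) = e by
        obtain ⟨e, h⟩ := h
        exact ⟨e, fun h => absurd h hQ, fun _ => h⟩
      have hQ' : ∀ e : Sym2 V, ∃ b ∉ A, G.Adj v b ∧ s(v, b) ≠ e := by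
        intro e
        by_contra! hh
        exact hQ ⟨e, hh⟩
      by_cases hp : p ∈ A
      · refine ⟨s(p, v), fun a ha hva => ?_⟩
        by_contra hne
        obtain ⟨b, hb, hvb, hbe⟩ := hQ' s(v, q)
        obtain ⟨c, hc, hvc, hce⟩ := hQ' s(v, r)
        have h1 := (hadj a).1 hva
        have h2 := (hadj b).1 hvb
        have h3 := (hadj c).1 hvc
        grind only
      · refine ⟨if q ∈ A then s(q, v) else s(r, v), fun a ha hva => ?_⟩
        obtain ⟨b, hb, hvb, hbe⟩ := hQ' s(v, p)
        have h1 := (hadj a).1 hva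
        have h2 := (hadj b).1 hvb
        grind only
  choose e he1 he2 using he
  refine hG.false (S := {v | v ∈ A ∨ v ∈ S ∧ Q v}) (x := x) (y := y) (e s) (e t)
    (Or.inl ⟨x.2, Reachable.refl _⟩) ?_ ?_
  · rintro (⟨h1, h2⟩ | h1)
    · exact hxy h2
    · exact y.2 h1.1
  · rintro a ha b hb hab
    simp only [Set.mem_ofPred_eq, not_or, not_and] at hb
    rcases ha with ha | ⟨ha, haQ⟩
    · have hbS : b ∈ S := by
        by_contra hbS
        exact hb.1 (hA a ha b hbS hab)
      have := he2 b (hb.2 hbS) a ha hab.symm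
      rcases hst b hbS with rfl | rfl
      · exact Or.inl this
      · exact Or.inr this
    · have := he1 a haQ b hb.1 hab
      rcases hst a ha with rfl | rfl
      · exact Or.inl this
      · exact Or.inr this

theorem IsThreeEdgeConnected.connected [Nonempty V] (hG : G.IsThreeEdgeConnected) :
    G.Connected := by
  refine ⟨fun x y => ?_⟩
  by_contra hxy
  exact hG.false (S := {v | G.Reachable x v}) (x := x) (y := y) s(x, x) s(x, x)
    (Reachable.refl _) hxy fun a ha b hb hab => absurd (ha.trans hab.reachable) hb

end SimpleGraph

namespace SimpleGraph

variable {V : Type u} {G : SimpleGraph V}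

/-! ### Rotation systems of cubic graphs as functions on pairs of vertices -/

/-- The function `f` describes a rotation system of a cubic graph: `f v` permutes the three
neighbours of `v` cyclically. -/
structure IsCubicRotation (G : SimpleGraph V) (f : V → V → V) : Prop where
  adj : ∀ {v w}, G.Adj v w → G.Adj v (f v w)
  ne : ∀ {v w}, G.Adj v w → f v w ≠ w
  cube : ∀ {v w}, G.Adj v w → f v (f v (f v w)) = w
  mem : ∀ {v w x}, G.Adj v w → G.Adj v x → x = w ∨ x = f v w ∨ x = f v (f v w)
  exists_adj : ∀ v, ∃ w, G.Adj v w

/-- The rotation `f` has no cohomology in degree one with coefficients in `ZMod 2`. The face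
permutation of `f` maps the dart `u → v` to `v → f v u`. -/
def IsAcyclicRotation (G : SimpleGraph V) (f : V → V → V) : Prop :=
  ∀ h : V → V → ZMod 2,
    (∀ u v, G.Adj u v → h u v + h v (f v u) = h v u + h u (f u v)) →
    ∃ φ : V → ZMod 2, ∀ u v, G.Adj u v → h u v + h v (f v u) = φ u + φ v

namespace IsCubicRotation

variable {f : V → V → V}

theorem ne' (hf : G.IsCubicRotation f) {v w : V} (h : G.Adj v w) : f v (f v w) ≠ w := by
  intro h2
  have := hf.cube h
  rw [h2] at this
  exact hf.ne h this

theorem inj (hf : G.IsCubicRotation f) {v w x : V} (hw : G.Adj v w) (hx : G.Adj v x)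
    (h : f v w = f v x) : w = x := by
  rw [← hf.cube hw, h, hf.cube hx]

theorem adj_iff (hf : G.IsCubicRotation f) {v w x : V} (h : G.Adj v w) :
    G.Adj v x ↔ x = w ∨ x = f v w ∨ x = f v (f v w) := by
  refine ⟨hf.mem h, ?_⟩
  rintro (rfl | rfl | rfl)
  · exact h
  · exact hf.adj h
  · exact hf.adj (hf.adj h)

theorem isCubic (hf : G.IsCubicRotation f) : G.IsCubic :=
  isCubic_of_neighbors fun v => by
    obtain ⟨w, hw⟩ := hf.exists_adj v
    exact ⟨w, f v w, f v (f v w), (hf.ne hw).symm, (hf.ne' hw).symm, (hf.ne (hf.adj hw)).symm,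
      fun x => hf.adj_iff hw⟩

/-- The rotation system described by `f`. -/
def toRotationSystem (hf : G.IsCubicRotation f) : G.RotationSystem where
  rot :=
    { toFun := fun d => ⟨(d.fst, f d.fst d.snd), hf.adj d.adj⟩
      invFun := fun d => ⟨(d.fst, f d.fst (f d.fst d.snd)), hf.adj (hf.adj d.adj)⟩
      left_inv := fun d => Dart.ext _ _ (Prod.ext rfl (hf.cube d.adj))
      right_inv := fun d => Dart.ext _ _ (Prod.ext rfl (hf.cube d.adj)) }
  rot_fst := fun _ => rfl
  rot_cycle := by
    rintro ⟨⟨u, v⟩, huv⟩ ⟨⟨u', w⟩, huw⟩ h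
    obtain rfl : u = u' := h
    rcases hf.mem huv huw with rfl | rfl | rfl
    · exact Equiv.Perm.SameCycle.refl _ _
    · exact ⟨1, rfl⟩
    · exact ⟨2, rfl⟩

end IsCubicRotation

namespace RotationSystem

variable {f : V → V → V}

/-- The rotation system `R` is described by `f`. -/
def IsDescribedBy (R : G.RotationSystem) (f : V → V → V) : Prop :=
  ∀ u v (h : G.Adj u v), (R.rot ⟨(u, v), h⟩).snd = f u v

theorem IsDescribedBy.adj {R : G.RotationSystem} (hR : R.IsDescribedBy f) {u v : V}
    (h : G.Adj u v) : G.Adj u (f u v) := by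
  rw [← hR u v h]
  have h1 := (R.rot ⟨(u, v), h⟩).adj
  rwa [R.rot_fst] at h1

theorem IsDescribedBy.rot_eq {R : G.RotationSystem} (hR : R.IsDescribedBy f) {u v : V}
    (h : G.Adj u v) : R.rot ⟨(u, v), h⟩ = ⟨(u, f u v), hR.adj h⟩ :=
  Dart.ext _ _ (Prod.ext (R.rot_fst _) (hR u v h))

theorem IsDescribedBy.faceNext_eq {R : G.RotationSystem} (hR : R.IsDescribedBy f) {u v : V}
    (h : G.Adj u v) : R.faceNext ⟨(u, v), h⟩ = ⟨(v, f v u), hR.adj h.symm⟩ :=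
  hR.rot_eq h.symm

theorem IsDescribedBy.consecutive {R : G.RotationSystem} (hR : R.IsDescribedBy f) {u v w : V}
    (h : G.Adj u v) (hw : f v u = w) : R.Consecutive u v w := by
  subst hw
  exact ⟨h, hR.adj h.symm, hR.faceNext_eq h⟩

theorem IsDescribedBy.isAcyclic_iff {R : G.RotationSystem} (hR : R.IsDescribedBy f) :
    R.IsAcyclic ↔ G.IsAcyclicRotation f := by
  classical
  constructor
  · intro hac h hh
    obtain ⟨φ, hφ⟩ := hac (fun d => h d.fst d.snd) (by
      rintro ⟨⟨u, v⟩, huv⟩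
      rw [show (⟨(u, v), huv⟩ : G.Dart).symm = ⟨(v, u), huv.symm⟩ from rfl, hR.faceNext_eq,
        hR.faceNext_eq]
      exact hh u v huv)
    refine ⟨φ, fun u v huv => ?_⟩
    have := hφ ⟨(u, v), huv⟩
    rwa [hR.faceNext_eq] at this
  · intro hac h hh
    have key : ∀ u v (huv : G.Adj u v),
        (if h' : G.Adj u v then h ⟨(u, v), h'⟩ else 0) = h ⟨(u, v), huv⟩ :=
      fun u v huv => dif_pos huv
    obtain ⟨φ, hφ⟩ := hac (fun u v => if h' : G.Adj u v then h ⟨(u, v), h'⟩ else 0) (by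
      intro u v huv
      have := hh ⟨(u, v), huv⟩
      rw [show (⟨(u, v), huv⟩ : G.Dart).symm = ⟨(v, u), huv.symm⟩ from rfl, hR.faceNext_eq,
        hR.faceNext_eq] at this
      rw [key u v huv, key v u huv.symm, key v _ (hR.adj huv.symm), key u _ (hR.adj huv)]
      exact this)
    refine ⟨φ, ?_⟩
    rintro ⟨⟨u, v⟩, huv⟩
    have := hφ u v huv
    rw [key u v huv, key v _ (hR.adj huv.symm)] at this
    rw [hR.faceNext_eq]
    exact this

/-- The darts at a vertex form one cycle of length three, so `rot` has neither fixed points nor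
2-cycles there; each would be an invariant set too small to contain all three darts. -/
theorem exists_isDescribedBy (R : G.RotationSystem) (hG : G.IsCubic) :
    ∃ f, G.IsCubicRotation f ∧ R.IsDescribedBy f := by
  classical
  -- The value at non-adjacent pairs is arbitrary and never used.
  let f : V → V → V := fun u v => if h : G.Adj u v then (R.rot ⟨(u, v), h⟩).snd else v
  have hR : R.IsDescribedBy f := fun u v h => by
    simp only [f, dif_pos h]
  have hthree : ∀ {v a b c x}, G.Adj v a → G.Adj v b → G.Adj v c → G.Adj v x → a ≠ b → a ≠ c →
      b ≠ c → x = a ∨ x = b ∨ x = c := by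
    intro v a b c x ha hb hc hx hab hac hbc
    obtain ⟨p, q, r, -, -, -, h⟩ := hG.exists_neighbors v
    rw [h] at ha hb hc hx
    grind only
  have hinj : ∀ {v w x} (hw : G.Adj v w) (hx : G.Adj v x), f v w = f v x → w = x := by
    intro v w x hw hx h
    have : R.rot ⟨(v, w), hw⟩ = R.rot ⟨(v, x), hx⟩ := by
      rw [hR.rot_eq, hR.rot_eq]
      exact Dart.ext _ _ (Prod.ext rfl h)
    have := congrArg (fun d => d.snd) (R.rot.injective this)
    exact this
  have hne : ∀ {v w}, G.Adj v w → f v w ≠ w := by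
    intro v w hw h
    have hfix : R.rot ⟨(v, w), hw⟩ = ⟨(v, w), hw⟩ := by
      rw [hR.rot_eq]
      exact Dart.ext _ _ (Prod.ext rfl h)
    have hall : ∀ x, G.Adj v x → w = x := by
      intro x hx
      have := Equiv.Perm.SameCycle.apply_eq (h := fun d => d = (⟨(v, w), hw⟩ : G.Dart))
        (σ := R.rot) (fun d => propext ⟨fun hd => R.rot.injective (hd.trans hfix.symm),
          fun hd => hd ▸ hfix⟩) (R.rot_cycle ⟨(v, w), hw⟩ ⟨(v, x), hx⟩ rfl)
      have h2 := this.mp rfl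
      exact (congrArg (fun d : G.Dart => d.snd) h2).symm
    obtain ⟨p, q, r, hpq, -, -, h⟩ := hG.exists_neighbors v
    exact hpq ((hall p ((h p).2 (by simp))).symm.trans (hall q ((h q).2 (by simp))))
  have hne2 : ∀ {v w}, G.Adj v w → f v (f v w) ≠ w := by
    intro v w hw h
    have hfix : R.rot (R.rot ⟨(v, w), hw⟩) = ⟨(v, w), hw⟩ := by
      rw [hR.rot_eq, hR.rot_eq]
      exact Dart.ext _ _ (Prod.ext rfl h)
    have hall : ∀ x, G.Adj v x → x = w ∨ x = f v w := by
      intro x hx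
      have := Equiv.Perm.SameCycle.apply_eq
        (h := fun d => d = (⟨(v, w), hw⟩ : G.Dart) ∨ d = R.rot ⟨(v, w), hw⟩)
        (σ := R.rot) (fun d => propext ⟨?_, ?_⟩)
        (R.rot_cycle ⟨(v, w), hw⟩ ⟨(v, x), hx⟩ rfl)
      · have h2 := this.mp (Or.inl rfl)
        rw [hR.rot_eq] at h2
        exact h2.imp (fun h => congrArg (fun d : G.Dart => d.snd) h)
          fun h => congrArg (fun d : G.Dart => d.snd) h
      · rintro (hd | hd)
        · exact Or.inr (R.rot.injective (hd.trans hfix.symm))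
        · exact Or.inl (R.rot.injective hd)
      · rintro (hd | hd)
        · exact Or.inr (congrArg R.rot hd)
        · exact Or.inl ((congrArg R.rot hd).trans hfix)
    obtain ⟨p, q, r, hpq, hpr, hqr, h⟩ := hG.exists_neighbors v
    have h1 := hall p ((h p).2 (by simp))
    have h2 := hall q ((h q).2 (by simp))
    have h3 := hall r ((h r).2 (by simp))
    grind only
  have hmem : ∀ {v w x}, G.Adj v w → G.Adj v x → x = w ∨ x = f v w ∨ x = f v (f v w) :=
    fun hw hx => hthree hw (hR.adj hw) (hR.adj (hR.adj hw)) hx (hne hw).symm (hne2 hw).symm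
      (hne (hR.adj hw)).symm
  refine ⟨f, ⟨fun h => hR.adj h, hne, ?_, hmem, fun v => ?_⟩, hR⟩
  · intro v w hw
    rcases hmem hw (hR.adj (hR.adj (hR.adj hw))) with h | h | h
    · exact h
    · exact absurd h (hne2 (hR.adj hw))
    · exact absurd h (hne (hR.adj (hR.adj hw)))
  · obtain ⟨p, q, r, -, -, -, h⟩ := hG.exists_neighbors v
    exact ⟨p, (h p).2 (by simp)⟩

end RotationSystem

/-- The function `f` describes a planar embedding of the three-connected cubic graph `G`. -/
structure IsPlanarCubicMap (G : SimpleGraph V) (f : V → V → V) : Prop where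
  rot : G.IsCubicRotation f
  acyclic : G.IsAcyclicRotation f
  conn : G.IsThreeEdgeConnected

theorem exists_isPlanarCubicMap [Finite V] (hreg : G.IsCubic) (hconn : G.IsThreeConnected)
    (hplanar : G.IsPlanar) : ∃ f, G.IsPlanarCubicMap f := by
  obtain ⟨R, hR⟩ := hplanar
  obtain ⟨f, hf, hRf⟩ := R.exists_isDescribedBy hreg
  have hne : Nonempty V := (Nat.card_pos_iff.1 (lt_trans (by norm_num) hconn.1)).1
  have h3 := hconn.isThreeEdgeConnected hreg
  rw [R.isPlanar_iff_isAcyclic h3.connected hf.exists_adj, hRf.isAcyclic_iff] at hR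
  exact ⟨f, hf, hR, h3⟩

namespace IsPlanarCubicMap

variable {f : V → V → V}

theorem exists_rotationSystem [Finite V] [Nonempty V] (hf : G.IsPlanarCubicMap f) :
    ∃ R : G.RotationSystem, R.IsPlanar ∧
      ∀ {u v w}, G.Adj u v → f v u = w → R.Consecutive u v w := by
  have hR : hf.rot.toRotationSystem.IsDescribedBy f := fun _ _ _ => rfl
  refine ⟨hf.rot.toRotationSystem, ?_, fun h hw => hR.consecutive h hw⟩
  rw [RotationSystem.isPlanar_iff_isAcyclic _ hf.conn.connected hf.rot.exists_adj,
    hR.isAcyclic_iff]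
  exact hf.acyclic

theorem isThreeConnected [Finite V] [Nonempty V] (hf : G.IsPlanarCubicMap f) :
    G.IsThreeConnected :=
  hf.conn.isThreeConnected hf.rot.isCubic (Classical.arbitrary V)

theorem isPlanar [Finite V] [Nonempty V] (hf : G.IsPlanarCubicMap f) : G.IsPlanar := by
  obtain ⟨R, hR, -⟩ := hf.exists_rotationSystem
  exact ⟨R, hR⟩

end IsPlanarCubicMap

end SimpleGraph

namespace SimpleGraph

variable {V : Type u} {G : SimpleGraph V}

/-! ### Contraction-elongation -/

theorem isCubicRotation_of_cycles {f : V → V → V}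
    (h : ∀ v, ∃ p q r, p ≠ q ∧ p ≠ r ∧ q ≠ r ∧ (∀ w, G.Adj v w ↔ w = p ∨ w = q ∨ w = r) ∧
      f v p = q ∧ f v q = r ∧ f v r = p) : G.IsCubicRotation f where
  adj := by
    intro v w hw
    obtain ⟨p, q, r, -, -, -, hadj, h1, h2, h3⟩ := h v
    rw [hadj] at hw ⊢
    rcases hw with rfl | rfl | rfl <;> simp [*]
  ne := by
    intro v w hw
    obtain ⟨p, q, r, hpq, hpr, hqr, hadj, h1, h2, h3⟩ := h v
    rw [hadj] at hw
    rcases hw with rfl | rfl | rfl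
    · rw [h1]; exact hpq.symm
    · rw [h2]; exact hqr.symm
    · rw [h3]; exact hpr
  cube := by
    intro v w hw
    obtain ⟨p, q, r, -, -, -, hadj, h1, h2, h3⟩ := h v
    rw [hadj] at hw
    rcases hw with rfl | rfl | rfl <;> simp [*]
  mem := by
    intro v w x hw hx
    obtain ⟨p, q, r, -, -, -, hadj, h1, h2, h3⟩ := h v
    rw [hadj] at hw hx
    rcases hw with rfl | rfl | rfl <;> rcases hx with rfl | rfl | rfl <;> simp [*]
  exists_adj := by
    intro v
    obtain ⟨p, q, r, -, -, -, hadj, -⟩ := h v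
    exact ⟨p, (hadj p).2 (Or.inl rfl)⟩

theorem IsCubicRotation.exists_cycle {f : V → V → V} (hf : G.IsCubicRotation f) (v : V) :
    ∃ p q r, p ≠ q ∧ p ≠ r ∧ q ≠ r ∧ (∀ w, G.Adj v w ↔ w = p ∨ w = q ∨ w = r) ∧
      f v p = q ∧ f v q = r ∧ f v r = p := by
  obtain ⟨w, hw⟩ := hf.exists_adj v
  exact ⟨w, f v w, f v (f v w), (hf.ne hw).symm, (hf.ne' hw).symm, (hf.ne (hf.adj hw)).symm,
    fun x => hf.adj_iff hw, rfl, rfl, hf.cube hw⟩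

/-- The surroundings of an edge `v₁ v₂`, on which a contraction-elongation operation can be carried
out such that the result is a simple cubic graph. -/
structure IsFlipConfiguration (G : SimpleGraph V) (f : V → V → V) (v₁ v₂ u₁ u₂ u₃ u₄ : V) :
    Prop where
  adj : G.Adj v₁ v₂
  rot₁ : f v₁ u₁ = v₂
  rot₁' : f v₁ v₂ = u₂
  rot₁'' : f v₁ u₂ = u₁
  rot₂ : f v₂ v₁ = u₃
  rot₂' : f v₂ u₃ = u₄
  rot₂'' : f v₂ u₄ = v₁
  ne₁₃ : u₁ ≠ u₃
  ne₂₃ : u₂ ≠ u₃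
  ne₂₄ : u₂ ≠ u₄

/-- The renaming of the neighbours of `a` under a contraction-elongation operation. -/
def flipPerm [DecidableEq V] (v₁ v₂ u₂ u₃ a : V) : Equiv.Perm V :=
  if a = u₂ ∨ a = u₃ then Equiv.swap v₁ v₂ else 1

/-- The rotation after a contraction-elongation operation. -/
def flipRotation [DecidableEq V] (f : V → V → V) (v₁ v₂ u₁ u₂ u₃ u₄ : V) (a b : V) : V :=
  if a = v₁ then if b = u₁ then u₃ else if b = u₃ then v₂ else u₁
  else if a = v₂ then if b = v₁ then u₄ else if b = u₄ then u₂ else v₁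
  else flipPerm v₁ v₂ u₂ u₃ a (f a (flipPerm v₁ v₂ u₂ u₃ a b))

theorem contractElongate_adj {v₁ v₂ u₂ u₃ a b : V} :
    (G.contractElongate v₁ v₂ u₂ u₃).Adj a b ↔
      (G.Adj a b ∧ s(a, b) ≠ s(v₁, u₂) ∧ s(a, b) ≠ s(v₂, u₃)) ∨
        ((s(a, b) = s(v₁, u₃) ∨ s(a, b) = s(v₂, u₂)) ∧ a ≠ b) := by
  simp only [contractElongate, sup_adj, deleteEdges_adj, fromEdgeSet_adj, Set.mem_insert_iff,
    Set.mem_singleton_iff, not_or, ne_eq]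

theorem flipPerm_flipPerm [DecidableEq V] (v₁ v₂ u₂ u₃ a b : V) :
    flipPerm v₁ v₂ u₂ u₃ a (flipPerm v₁ v₂ u₂ u₃ a b) = b := by
  unfold flipPerm
  split_ifs <;> simp

namespace IsFlipConfiguration

variable {f : V → V → V} {v₁ v₂ u₁ u₂ u₃ u₄ : V}

/-- The configuration seen from the other end of the edge. -/
theorem symm (hF : G.IsFlipConfiguration f v₁ v₂ u₁ u₂ u₃ u₄) :
    G.IsFlipConfiguration f v₂ v₁ u₄ u₃ u₂ u₁ :=
  ⟨hF.adj.symm, hF.rot₂'', hF.rot₂, hF.rot₂', hF.rot₁', hF.rot₁'', hF.rot₁, hF.ne₂₄.symm,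
    hF.ne₂₃.symm, hF.ne₁₃.symm⟩

section

variable (hf : G.IsCubicRotation f) (hF : G.IsFlipConfiguration f v₁ v₂ u₁ u₂ u₃ u₄)
include hf hF

theorem adj₁ (w : V) : G.Adj v₁ w ↔ w = v₂ ∨ w = u₂ ∨ w = u₁ := by
  rw [hf.adj_iff hF.adj, hF.rot₁', hF.rot₁'']

theorem adj₂ (w : V) : G.Adj v₂ w ↔ w = v₁ ∨ w = u₃ ∨ w = u₄ := by
  rw [hf.adj_iff hF.adj.symm, hF.rot₂, hF.rot₂']

theorem basic_ne : v₁ ≠ v₂ ∧ (u₁ ≠ v₁ ∧ u₁ ≠ v₂ ∧ u₂ ≠ v₁ ∧ u₂ ≠ v₂) ∧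
    (u₃ ≠ v₁ ∧ u₃ ≠ v₂ ∧ u₄ ≠ v₁ ∧ u₄ ≠ v₂) ∧ u₁ ≠ u₂ ∧ u₃ ≠ u₄ := by
  have h1 := (hF.adj₁ hf u₁).2 (by simp)
  have h2 := (hF.adj₁ hf u₂).2 (by simp)
  have h3 := (hF.adj₂ hf u₃).2 (by simp)
  have h4 := (hF.adj₂ hf u₄).2 (by simp)
  refine ⟨hF.adj.ne, ⟨h1.ne', ?_, h2.ne', ?_⟩, ⟨?_, h3.ne', ?_, h4.ne'⟩, ?_, ?_⟩
  · have := hf.ne h1; rw [hF.rot₁] at this; exact this.symm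
  · have := hf.ne hF.adj; rwa [hF.rot₁'] at this
  · have := hf.ne hF.adj.symm; rwa [hF.rot₂] at this
  · have := hf.ne h4; rw [hF.rot₂''] at this; exact this.symm
  · have := hf.ne h2; rwa [hF.rot₁''] at this
  · have := hf.ne h3; rw [hF.rot₂'] at this; exact this.symm

theorem flip_adj₁ (w : V) :
    (G.contractElongate v₁ v₂ u₂ u₃).Adj v₁ w ↔ w = u₁ ∨ w = u₃ ∨ w = v₂ := by
  obtain ⟨h0, ⟨h1, h2, h3, h4⟩, ⟨h5, h6, h7, h8⟩, h9, h10⟩ := hF.basic_ne hf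
  have := hF.ne₁₃
  have := hF.ne₂₃
  rw [contractElongate_adj, hF.adj₁ hf]
  simp only [ne_eq, Sym2.eq_iff]
  grind only

theorem flip_adj₂ (w : V) :
    (G.contractElongate v₁ v₂ u₂ u₃).Adj v₂ w ↔ w = v₁ ∨ w = u₄ ∨ w = u₂ := by
  obtain ⟨h0, ⟨h1, h2, h3, h4⟩, ⟨h5, h6, h7, h8⟩, h9, h10⟩ := hF.basic_ne hf
  have := hF.ne₂₄
  have := hF.ne₂₃
  rw [contractElongate_adj, hF.adj₂ hf]
  simp only [ne_eq, Sym2.eq_iff]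
  grind only

theorem flip_adj [DecidableEq V] {a : V} (h₁ : a ≠ v₁) (h₂ : a ≠ v₂) (w : V) :
    (G.contractElongate v₁ v₂ u₂ u₃).Adj a w ↔ G.Adj a (flipPerm v₁ v₂ u₂ u₃ a w) := by
  obtain ⟨h0, ⟨h1, h2, h3, h4⟩, ⟨h5, h6, h7, h8⟩, h9, h10⟩ := hF.basic_ne hf
  have := hF.ne₂₄
  have := hF.ne₂₃
  have := hF.ne₁₃
  have k1 := hF.adj₁ hf a
  have k2 := hF.adj₂ hf a
  rw [G.adj_comm] at k1 k2
  rw [contractElongate_adj]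
  simp only [ne_eq, Sym2.eq_iff, flipPerm]
  split_ifs with ha
  · simp only [Equiv.swap_apply_def]
    split_ifs with hw1 hw2
    · subst hw1
      grind only
    · subst hw2
      grind only
    · grind only
  · simp only [Equiv.Perm.one_apply]
    grind only

theorem isCubicRotation [DecidableEq V] :
    (G.contractElongate v₁ v₂ u₂ u₃).IsCubicRotation (flipRotation f v₁ v₂ u₁ u₂ u₃ u₄) := by
  obtain ⟨h0, ⟨h1, h2, h3, h4⟩, ⟨h5, h6, h7, h8⟩, h9, h10⟩ := hF.basic_ne hf
  refine isCubicRotation_of_cycles fun a => ?_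
  by_cases ha₁ : a = v₁
  · subst ha₁
    refine ⟨u₁, u₃, v₂, hF.ne₁₃, h2, h6, hF.flip_adj₁ hf, ?_, ?_, ?_⟩ <;>
      simp [flipRotation, hF.ne₁₃.symm, h2.symm, h6.symm]
  by_cases ha₂ : a = v₂
  · subst ha₂
    refine ⟨v₁, u₄, u₂, h7.symm, h3.symm, hF.ne₂₄.symm, hF.flip_adj₂ hf, ?_, ?_, ?_⟩ <;>
      simp [flipRotation, h0.symm, h7, h3, hF.ne₂₄]
  obtain ⟨p, q, r, hpq, hpr, hqr, hadj, h1, h2, h3⟩ := hf.exists_cycle a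
  set σ := flipPerm v₁ v₂ u₂ u₃ a with hσ
  have hσσ : ∀ b, σ (σ b) = b := flipPerm_flipPerm v₁ v₂ u₂ u₃ a
  have hrot : ∀ b, flipRotation f v₁ v₂ u₁ u₂ u₃ u₄ a (σ b) = σ (f a b) := fun b => by
    unfold flipRotation
    rw [if_neg ha₁, if_neg ha₂, ← hσ, hσσ]
  have hinj : ∀ b c, σ b = c ↔ b = σ c := fun b c =>
    ⟨fun h => by rw [← h, hσσ], fun h => by rw [h, hσσ]⟩
  refine ⟨σ p, σ q, σ r, σ.injective.ne hpq, σ.injective.ne hpr, σ.injective.ne hqr, fun w => ?_,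
    ?_, ?_, ?_⟩
  · rw [hF.flip_adj hf ha₁ ha₂, hadj, ← hσ, hinj, hinj, hinj]
  · rw [hrot, h1]
  · rw [hrot, h2]
  · rw [hrot, h3]

end

end IsFlipConfiguration

end SimpleGraph

/-! ### Planarity and edge connectivity after contraction-elongation -/

namespace SimpleGraph

variable {V : Type u} {G : SimpleGraph V}

theorem contractElongate_symm (G : SimpleGraph V) (v₁ v₂ u₂ u₃ : V) :
    G.contractElongate v₂ v₁ u₃ u₂ = G.contractElongate v₁ v₂ u₂ u₃ := by
  ext a b
  rw [contractElongate_adj, contractElongate_adj]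
  tauto

namespace IsFlipConfiguration

variable {f : V → V → V} {v₁ v₂ u₁ u₂ u₃ u₄ : V}

/-- By `hm` the cochain of `h'` vanishes on the new edge, so it lives on the graph with that edge
contracted, which is also `G` with v₁v₂ contracted. It is pulled back to `G`; there the potential φ
takes equal values at v₁ and v₂, so the same φ works after the operation. -/
theorem isAcyclicRotation_aux [DecidableEq V] (hf : G.IsCubicRotation f)
    (hac : G.IsAcyclicRotation f) (hF : G.IsFlipConfiguration f v₁ v₂ u₁ u₂ u₃ u₄)
    {f' : V → V → V} (hf' : f' = flipRotation f v₁ v₂ u₁ u₂ u₃ u₄) (h' : V → V → ZMod 2)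
    (hh : ∀ u v, (G.contractElongate v₁ v₂ u₂ u₃).Adj u v →
      h' u v + h' v (f' v u) = h' v u + h' u (f' u v))
    (hm : h' v₂ v₁ + h' v₁ (f' v₁ v₂) = 0) :
    ∃ φ : V → ZMod 2, ∀ u v, (G.contractElongate v₁ v₂ u₂ u₃).Adj u v →
      h' u v + h' v (f' v u) = φ u + φ v := by
  obtain ⟨h0, ⟨h1, h2, h3, h4⟩, ⟨h5, h6, h7, h8⟩, h9, h10⟩ := hF.basic_ne hf
  have h13 := hF.ne₁₃
  have h23 := hF.ne₂₃
  have h24 := hF.ne₂₄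
  have hfv : f' v₁ v₂ = u₁ ∧ f' v₁ u₁ = u₃ ∧ f' v₁ u₃ = v₂ ∧ f' v₂ v₁ = u₄ ∧ f' v₂ u₄ = u₂ ∧
      f' v₂ u₂ = v₁ := by
    subst hf'
    simp [flipRotation, *, h0.symm, h2.symm, h6.symm, h13.symm]
  obtain ⟨f1, f2, f3, f4, f5, f6⟩ := hfv
  set σ := flipPerm v₁ v₂ u₂ u₃ with hσ
  have hσσ : ∀ a b, σ a (σ a b) = b := flipPerm_flipPerm v₁ v₂ u₂ u₃
  have hf'' : ∀ a b, a ≠ v₁ → a ≠ v₂ → f' a b = σ a (f a (σ a b)) := fun a b ha hb => by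
    subst hf'
    simp [flipRotation, ha, hb, hσ]
  have hm1 : h' v₂ v₁ = h' v₁ u₁ := by
    rw [f1] at hm
    exact CharTwo.add_eq_zero.1 hm
  have hm2 : h' v₁ v₂ = h' v₂ u₄ := by
    have := hh v₁ v₂ ((hF.flip_adj₁ hf v₂).2 (by simp))
    rw [hm, f4] at this
    exact CharTwo.add_eq_zero.1 this
  have hσ1 : ∀ a, a ≠ u₂ → a ≠ u₃ → ∀ b, σ a b = b := fun a h h' b => by
    simp [hσ, flipPerm, h, h']
  have hσ2 : ∀ a, a = u₂ ∨ a = u₃ → σ a = Equiv.swap v₁ v₂ := fun a h => by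
    simp [hσ, flipPerm, h]
  have hσ3 : ∀ a b, b ≠ v₁ → b ≠ v₂ → σ a b = b := fun a b h h' => by
    rw [hσ, flipPerm]
    split_ifs
    · exact Equiv.swap_apply_of_ne_of_ne h h'
    · rfl
  -- Each dart of v₁v₂ gets the value of its successor in `G`, which makes the cochain of `h` vanish
  -- on this edge. All other darts keep their values up to the renaming of v₁ and v₂ at u₂ and u₃.
  let h : V → V → ZMod 2 := fun a b =>
    if (a = v₁ ∧ b = v₂) ∨ (a = v₂ ∧ b = u₃) then h' v₁ u₃
    else if (a = v₂ ∧ b = v₁) ∨ (a = v₁ ∧ b = u₂) then h' v₂ u₂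
    else h' a (σ a b)
  have hA : ∀ a b, G.Adj a b → b ≠ v₁ → b ≠ v₂ → h a b = h' (σ b a) b := by
    intro a b hab hb₁ hb₂
    by_cases ha₁ : a = v₁
    · subst ha₁
      rcases (hF.adj₁ hf b).1 hab with rfl | rfl | rfl
      · exact absurd rfl hb₂
      · simp [h, h3, h4, h0, hσ2]
      · simp [h, h1, h2, h0, hσ1 _ h9 h13, hσ1 _ h3.symm h5.symm, h9]
    by_cases ha₂ : a = v₂
    · subst ha₂
      rcases (hF.adj₂ hf b).1 hab with rfl | rfl | rfl
      · exact absurd rfl hb₁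
      · simp [h, h6, ha₁, hσ2]
      · simp [h, h7, h8, ha₁, hσ1 _ h24.symm h10.symm, hσ1 _ h4.symm h6.symm, h10.symm]
    · simp [h, ha₁, ha₂, hσ3 _ _ ha₁ ha₂, hσ3 _ _ hb₁ hb₂]
  have hB : ∀ a b, b ≠ v₁ → b ≠ v₂ → h b a = h' b (σ b a) := by
    intro a b hb₁ hb₂
    simp [h, hb₁, hb₂]
  have hM : ∀ a b, G.Adj a b → b ≠ v₁ → b ≠ v₂ →
      h a b + h b (f b a) = h' (σ b a) b + h' b (f' b (σ b a)) := by
    intro a b hab hb₁ hb₂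
    rw [hA a b hab hb₁ hb₂, hB _ _ hb₁ hb₂, hf'' b _ hb₁ hb₂, hσσ]
  have hMv : ∀ a b, G.Adj a b → (b = v₁ ∨ b = v₂) → a ≠ v₁ → a ≠ v₂ →
      h a b + h b (f b a) = h' a (σ a b) + h' (σ a b) (f' (σ a b) a) := by
    intro a b hab hb ha₁ ha₂
    rw [hB b a ha₁ ha₂]
    congr 1
    rcases hb with rfl | rfl
    · rcases (hF.adj₁ hf a).1 hab.symm with rfl | rfl | rfl
      · exact absurd rfl ha₂
      · rw [hσ2 _ (Or.inl rfl), Equiv.swap_apply_left, hF.rot₁'', f6, hm1]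
        simp [h, h0, h9, h2, hσ1 _ h3.symm h5.symm]
      · rw [hσ1 _ h9 h13, hF.rot₁, f2]
        simp [h]
    · rcases (hF.adj₂ hf a).1 hab.symm with rfl | rfl | rfl
      · exact absurd rfl ha₁
      · rw [hσ2 _ (Or.inr rfl), Equiv.swap_apply_right, hF.rot₂', f3, hm2]
        simp [h, h0.symm, h10.symm, h7, hσ1 _ h4.symm h6.symm]
      · rw [hσ1 _ h24.symm h10.symm, hF.rot₂'', f5]
        simp [h, h0.symm, h0, h5.symm]
  have hM1 : h v₁ v₂ + h v₂ (f v₂ v₁) = 0 := by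
    rw [hF.rot₂]
    simp [h, CharTwo.add_self_eq_zero]
  have hM2 : h v₂ v₁ + h v₁ (f v₁ v₂) = 0 := by
    rw [hF.rot₁']
    simp [h, h0, h0.symm, h4, h5.symm, CharTwo.add_self_eq_zero]
  have hadj : ∀ {a b}, G.Adj a b → b ≠ v₁ → b ≠ v₂ →
      (G.contractElongate v₁ v₂ u₂ u₃).Adj (σ b a) b := by
    intro a b hab hb₁ hb₂
    rw [adj_comm, hF.flip_adj hf hb₁ hb₂, ← hσ, hσσ]
    exact hab.symm
  have hσv : ∀ a b, b = v₁ ∨ b = v₂ → σ a b = v₁ ∨ σ a b = v₂ := by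
    intro a b hb
    rw [hσ, flipPerm]
    rcases hb with rfl | rfl <;> split_ifs <;> simp
  obtain ⟨φ, hφ⟩ := hac h (by
    intro a b hab
    by_cases hb : b = v₁ ∨ b = v₂
    · by_cases ha : a = v₁ ∨ a = v₂
      · rcases ha with rfl | rfl <;> rcases hb with rfl | rfl
        · exact absurd hab G.irrefl
        · rw [hM1, hM2]
        · rw [hM1, hM2]
        · exact absurd hab G.irrefl
      · rw [not_or] at ha
        rw [hMv a b hab hb ha.1 ha.2, hM b a hab.symm ha.1 ha.2]
        exact (hh _ _ (hadj hab.symm ha.1 ha.2)).symm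
    · rw [not_or] at hb
      by_cases ha : a = v₁ ∨ a = v₂
      · rw [hMv b a hab.symm ha hb.1 hb.2, hM a b hab hb.1 hb.2]
        exact hh _ _ (hadj hab hb.1 hb.2)
      · rw [not_or] at ha
        rw [hM a b hab hb.1 hb.2, hM b a hab.symm ha.1 ha.2, hσ3 _ _ ha.1 ha.2,
          hσ3 _ _ hb.1 hb.2]
        have := hh _ _ (hadj hab hb.1 hb.2)
        rwa [hσ3 _ _ ha.1 ha.2] at this)
  have hφv : φ v₁ = φ v₂ := CharTwo.add_eq_zero.1 ((hφ v₁ v₂ hF.adj).symm.trans hM1)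
  have hφσ : ∀ a b, φ (σ a b) = φ b := by
    intro a b
    by_cases hb : b = v₁ ∨ b = v₂
    · rcases hb with rfl | rfl
      · rcases hσv a _ (Or.inl rfl) with h | h <;> rw [h]
        exact hφv.symm
      · rcases hσv a _ (Or.inr rfl) with h | h <;> rw [h]
        exact hφv
    · rw [not_or] at hb
      rw [hσ3 _ _ hb.1 hb.2]
  have hfin : ∀ a b, (G.contractElongate v₁ v₂ u₂ u₃).Adj a b → b ≠ v₁ → b ≠ v₂ →
      h' a b + h' b (f' b a) = φ a + φ b := by
    intro a b hab hb₁ hb₂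
    have hab' : G.Adj (σ b a) b := by
      rw [adj_comm, hσ, ← hF.flip_adj hf hb₁ hb₂]
      exact hab.symm
    have := hM _ _ hab' hb₁ hb₂
    rw [hσσ] at this
    rw [← this, hφ _ _ hab', hφσ]
  refine ⟨φ, fun a b hab => ?_⟩
  by_cases hb : b = v₁ ∨ b = v₂
  · by_cases ha : a = v₁ ∨ a = v₂
    · rcases ha with rfl | rfl <;> rcases hb with rfl | rfl
      · exact absurd rfl hab.ne
      · rw [hh _ _ hab, hm, hφv, CharTwo.add_self_eq_zero]
      · rw [hm, hφv, CharTwo.add_self_eq_zero]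
      · exact absurd rfl hab.ne
    · rw [not_or] at ha
      rw [hh _ _ hab, hfin _ _ hab.symm ha.1 ha.2, add_comm]
  · rw [not_or] at hb
    exact hfin _ _ hab hb.1 hb.2

/-- Adding `m` to `h` on all darts leaving v₁ changes its cochain by the coboundary of `m` times the
indicator of v₁. With `m` the value on the new edge, the case of a cochain vanishing there applies.
-/
theorem isAcyclicRotation [DecidableEq V] (hf : G.IsCubicRotation f)
    (hac : G.IsAcyclicRotation f) (hF : G.IsFlipConfiguration f v₁ v₂ u₁ u₂ u₃ u₄) :
    (G.contractElongate v₁ v₂ u₂ u₃).IsAcyclicRotation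
      (flipRotation f v₁ v₂ u₁ u₂ u₃ u₄) := by
  intro h hh
  set f' := flipRotation f v₁ v₂ u₁ u₂ u₃ u₄ with hf'
  set m := h v₂ v₁ + h v₁ (f' v₁ v₂) with hm
  have h0 := hF.adj.ne
  obtain ⟨φ, hφ⟩ := hF.isAcyclicRotation_aux hf hac hf'
    (fun a b => h a b + if a = v₁ then m else 0)
    (fun a b hab => by linear_combination hh a b hab) (by
      simp only [h0.symm, if_true, if_false, add_zero]
      rw [← add_assoc, ← hm, CharTwo.add_self_eq_zero])
  refine ⟨fun a => φ a + if a = v₁ then m else 0, fun a b hab => ?_⟩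
  have h2 : ∀ x : ZMod 2, x + x = 0 := CharTwo.add_self_eq_zero
  linear_combination hφ a b hab - h2 (if a = v₁ then m else 0) - h2 (if b = v₁ then m else 0)

/-- A three-edge cut that obstructs the contraction-elongation operation on `v₁ v₂`. -/
def _root_.SimpleGraph.IsObstructingCut (G : SimpleGraph V) (v₁ v₂ u₁ u₂ u₃ u₄ : V)
    (T : Set V) (e : Sym2 V) : Prop :=
  (v₁ ∈ T ∧ v₂ ∈ T ∧ u₂ ∈ T ∧ u₄ ∈ T ∧ u₁ ∉ T ∧ u₃ ∉ T) ∧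
    ∀ a ∈ T, ∀ b ∉ T, G.Adj a b → s(a, b) = s(u₁, v₁) ∨ s(a, b) = s(v₂, u₃) ∨ s(a, b) = e

/-- Not both of u₁, u₃ are outside `S`, since `e` is only one edge. If exactly one is outside, its
edge to v₁ is `e`, which forces u₂ out of `S`; then only one edge of `G` leaves S \ {v₁}, namely
that from the other one of u₁, u₃ to its neighbour among v₁, v₂. -/
theorem mem_of_cut (hf : G.IsCubicRotation f) (hG : G.IsThreeEdgeConnected)
    (hF : G.IsFlipConfiguration f v₁ v₂ u₁ u₂ u₃ u₄) {S : Set V} {e : Sym2 V}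
    (hv₁ : v₁ ∈ S) (hv₂ : v₂ ∉ S)
    (hS : ∀ a ∈ S, ∀ b ∉ S, (G.contractElongate v₁ v₂ u₂ u₃).Adj a b →
      s(a, b) = s(v₁, v₂) ∨ s(a, b) = e) : u₁ ∈ S ∧ u₃ ∈ S := by
  obtain ⟨h0, ⟨h1, h2, h3, h4⟩, ⟨h5, h6, h7, h8⟩, h9, h10⟩ := hF.basic_ne hf
  have h13 := hF.ne₁₃
  have k1 : u₁ ∉ S → s(v₁, u₁) = e := fun h =>
    (hS v₁ hv₁ u₁ h ((hF.flip_adj₁ hf u₁).2 (by simp))).resolve_left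
      fun h => h2 (Sym2.congr_right.1 h)
  have k3 : u₃ ∉ S → s(v₁, u₃) = e := fun h =>
    (hS v₁ hv₁ u₃ h ((hF.flip_adj₁ hf u₃).2 (by simp))).resolve_left
      fun h => h6 (Sym2.congr_right.1 h)
  have k2 : u₂ ∈ S → s(u₂, v₂) = e := fun h =>
    (hS u₂ h v₂ hv₂ ((hF.flip_adj₂ hf u₂).2 (by simp)).symm).resolve_left
      fun h => h3 (Sym2.congr_left.1 h)
  have key : ∀ a ∈ S \ {v₁}, ∀ b ∉ S \ {v₁}, G.Adj a b →
      (b = v₁ ∧ (a = u₂ ∨ a = u₁)) ∨ (a = u₂ ∧ b = v₁) ∨ (a = u₃ ∧ b = v₂) ∨ s(a, b) = e := by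
    rintro a ⟨ha, ha'⟩ b hb hab
    rw [Set.mem_singleton_iff] at ha'
    by_cases hbS : b ∈ S
    · obtain rfl : b = v₁ := by
        by_contra h
        exact hb ⟨hbS, h⟩
      rcases (hF.adj₁ hf a).1 hab.symm with rfl | h | h
      · exact absurd ha hv₂
      · exact Or.inl ⟨rfl, Or.inl h⟩
      · exact Or.inl ⟨rfl, Or.inr h⟩
    · have h := hS a ha b hbS
      rw [contractElongate_adj] at h
      by_cases hc : a = u₃ ∧ b = v₂
      · exact Or.inr (Or.inr (Or.inl hc))
      · rcases h (Or.inl ⟨hab, by rw [ne_eq, Sym2.eq_iff]; grind only,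
          by rw [ne_eq, Sym2.eq_iff]; grind only⟩) with h | h
        · rw [Sym2.eq_iff] at h
          grind only
        · exact Or.inr (Or.inr (Or.inr h))
  by_contra hcon
  have hcase : (u₁ ∉ S ∧ u₃ ∈ S) ∨ (u₁ ∈ S ∧ u₃ ∉ S) := by
    by_cases hu₁ : u₁ ∈ S
    · exact Or.inr ⟨hu₁, fun h => hcon ⟨hu₁, h⟩⟩
    · refine Or.inl ⟨hu₁, ?_⟩
      by_contra hu₃
      exact h13 (Sym2.congr_right.1 ((k1 hu₁).trans (k3 hu₃).symm))
  have hu₂ : u₂ ∉ S := by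
    intro hu₂
    rcases hcase with h | h
    · have := (k2 hu₂).trans (k1 h.1).symm
      rw [Sym2.eq_iff] at this
      grind only
    · have := (k2 hu₂).trans (k3 h.2).symm
      rw [Sym2.eq_iff] at this
      grind only
  rcases hcase with ⟨hu₁, hu₃⟩ | ⟨hu₁, hu₃⟩
  · refine hG.false (S := S \ {v₁}) (x := u₃) (y := v₁) s(u₃, v₂) s(u₃, v₂) ⟨hu₃, h5⟩
      (fun h => h.2 rfl) fun a ha b hb hab => ?_
    have hk := key a ha b hb hab
    rw [← k1 hu₁] at hk
    rw [Set.mem_sdiff, Set.mem_singleton_iff] at ha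
    simp only [Sym2.eq_iff] at hk ⊢
    grind only
  · refine hG.false (S := S \ {v₁}) (x := u₁) (y := v₁) s(u₁, v₁) s(u₁, v₁) ⟨hu₁, h1⟩
      (fun h => h.2 rfl) fun a ha b hb hab => ?_
    have hk := key a ha b hb hab
    rw [← k3 hu₃] at hk
    rw [Set.mem_sdiff, Set.mem_singleton_iff] at ha
    simp only [Sym2.eq_iff] at hk ⊢
    grind only

/-- By `mem_of_cut` from both ends, u₁, u₃ lie on the side of v₁ and u₂, u₄ on that of v₂. Moving v₁
across then trades the new edge for u₁v₁ and v₂u₃ in `G`. -/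
theorem exists_isObstructingCut (hf : G.IsCubicRotation f) (hG : G.IsThreeEdgeConnected)
    (hF : G.IsFlipConfiguration f v₁ v₂ u₁ u₂ u₃ u₄) {S : Set V} {e : Sym2 V}
    (hv₁ : v₁ ∈ S) (hv₂ : v₂ ∉ S)
    (hS : ∀ a ∈ S, ∀ b ∉ S, (G.contractElongate v₁ v₂ u₂ u₃).Adj a b →
      s(a, b) = s(v₁, v₂) ∨ s(a, b) = e) :
    ∃ T e, G.IsObstructingCut v₁ v₂ u₁ u₂ u₃ u₄ T e := by
  obtain ⟨h0, ⟨h1, h2, h3, h4⟩, ⟨h5, h6, h7, h8⟩, h9, h10⟩ := hF.basic_ne hf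
  obtain ⟨hu₁, hu₃⟩ := hF.mem_of_cut hf hG hv₁ hv₂ hS
  obtain ⟨hu₄, hu₂⟩ := hF.symm.mem_of_cut hf hG (S := Sᶜ) (e := e) hv₂ (fun h => h hv₁) (by
    intro a ha b hb hab
    rw [contractElongate_symm] at hab
    have := hS b (not_not.1 hb) a ha hab.symm
    rwa [Sym2.eq_swap, Sym2.eq_swap (a := v₂)])
  refine ⟨Sᶜ ∪ {v₁}, e, ⟨Or.inr rfl, Or.inl hv₂, Or.inl hu₂, Or.inl hu₄,
    fun h => h.elim (fun h => h hu₁) h1, fun h => h.elim (fun h => h hu₃) h5⟩, ?_⟩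
  intro a ha b hb hab
  have hbS : b ∈ S ∧ b ≠ v₁ := by
    simpa [not_or, and_comm] using hb
  rcases ha with ha | rfl
  · have h := hS b hbS.1 a ha
    rw [contractElongate_adj, adj_comm] at h
    rw [Set.mem_compl_iff] at ha hu₂ hu₄
    have hbv₂ : b ≠ v₂ := fun h => hv₂ (h ▸ hbS.1)
    rw [Sym2.eq_swap (a := b)] at h
    by_cases hc : s(a, b) = s(v₂, u₃)
    · exact Or.inr (Or.inl hc)
    · have h' := h (Or.inl ⟨hab, by rw [ne_eq, Sym2.eq_iff]; grind only, hc⟩)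
      rcases h' with h' | h'
      · rw [Sym2.eq_iff] at h'
        grind only
      · exact Or.inr (Or.inr h')
  · rcases (hF.adj₁ hf b).1 hab with rfl | rfl | rfl
    · exact absurd hbS.1 hv₂
    · exact absurd hbS.1 hu₂
    · exact Or.inl Sym2.eq_swap

theorem isThreeEdgeConnected (hf : G.IsCubicRotation f) (hG : G.IsThreeEdgeConnected)
    (hF : G.IsFlipConfiguration f v₁ v₂ u₁ u₂ u₃ u₄)
    (hT : ∀ T e, ¬ G.IsObstructingCut v₁ v₂ u₁ u₂ u₃ u₄ T e) :
    (G.contractElongate v₁ v₂ u₂ u₃).IsThreeEdgeConnected := by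
  classical
  obtain ⟨h0, ⟨h1, h2, h3, h4⟩, ⟨h5, h6, h7, h8⟩, h9, h10⟩ := hF.basic_ne hf
  have hsep : ∀ (S : Set V) (e₁ e₂ : Sym2 V), (∀ a ∈ S, ∀ b ∉ S,
      (G.contractElongate v₁ v₂ u₂ u₃).Adj a b → s(a, b) = e₁ ∨ s(a, b) = e₂) →
      v₁ ∈ S → v₂ ∉ S → False := by
    intro S e₁ e₂ hS hv₁ hv₂
    obtain ⟨T, e, h⟩ : ∃ T e, G.IsObstructingCut v₁ v₂ u₁ u₂ u₃ u₄ T e := by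
      rcases hS v₁ hv₁ v₂ hv₂ ((hF.flip_adj₁ hf v₂).2 (by simp)) with rfl | rfl
      · exact hF.exists_isObstructingCut hf hG hv₁ hv₂ hS
      · exact hF.exists_isObstructingCut hf hG hv₁ hv₂ fun a ha b hb hab =>
          (hS a ha b hb hab).symm
    exact hT T e h
  have hnadj₁ : ¬ G.Adj v₂ u₂ := fun h => by
    have := hF.ne₂₃
    have := hF.ne₂₄
    have := (hF.adj₂ hf u₂).1 h
    grind only
  have hnadj₂ : ¬ G.Adj v₁ u₃ := fun h => by
    have := hF.ne₂₃
    have := hF.ne₁₃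
    have := (hF.adj₁ hf u₃).1 h
    grind only
  intro S e₁ e₂ hS
  by_cases hv : v₁ ∈ S ↔ v₂ ∈ S
  -- When v₁ and v₂ are on the same side, the cut of `S` in `G` is the cut in the new graph with the
  -- two moved edges renamed back by γ.
  · let γ : Sym2 V → Sym2 V := fun e =>
      if e = s(v₂, u₂) then s(v₁, u₂) else if e = s(v₁, u₃) then s(v₂, u₃) else e
    have hγ : ∀ {e e'}, (e = e₁ ∨ e = e₂) → γ e = e' → e' = γ e₁ ∨ e' = γ e₂ := by
      rintro e e' (rfl | rfl) rfl
      · exact Or.inl rfl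
      · exact Or.inr rfl
    have hγ₁ : γ s(v₂, u₂) = s(v₁, u₂) := if_pos rfl
    have hγ₂ : γ s(v₁, u₃) = s(v₂, u₃) := by
      have : s(v₁, u₃) ≠ s(v₂, u₂) := by
        rw [ne_eq, Sym2.eq_iff]
        grind only
      simp only [γ, if_neg this, if_true]
    refine hG S (γ e₁) (γ e₂) fun a ha b hb hab => ?_
    by_cases hab₁ : s(a, b) = s(v₁, u₂)
    · rw [hab₁]
      refine hγ ?_ hγ₁
      rcases Sym2.eq_iff.1 hab₁ with ⟨rfl, rfl⟩ | ⟨rfl, rfl⟩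
      · exact hS _ (hv.1 ha) _ hb ((hF.flip_adj₂ hf _).2 (by simp))
      · rw [Sym2.eq_swap]
        exact hS _ ha _ (mt hv.2 hb) ((hF.flip_adj₂ hf _).2 (by simp)).symm
    by_cases hab₂ : s(a, b) = s(v₂, u₃)
    · rw [hab₂]
      refine hγ ?_ hγ₂
      rcases Sym2.eq_iff.1 hab₂ with ⟨rfl, rfl⟩ | ⟨rfl, rfl⟩
      · exact hS _ (hv.2 ha) _ hb ((hF.flip_adj₁ hf _).2 (by simp))
      · rw [Sym2.eq_swap]
        exact hS _ ha _ (mt hv.1 hb) ((hF.flip_adj₁ hf _).2 (by simp)).symm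
    refine hγ (hS a ha b hb (contractElongate_adj.2 (Or.inl ⟨hab, hab₁, hab₂⟩))) ?_
    have n₁ : s(a, b) ≠ s(v₂, u₂) := fun h => hnadj₁ ((G.adj_congr_of_sym2 h).1 hab)
    have n₂ : s(a, b) ≠ s(v₁, u₃) := fun h => hnadj₂ ((G.adj_congr_of_sym2 h).1 hab)
    simp only [γ, if_neg n₁, if_neg n₂]
  · by_cases hv₁ : v₁ ∈ S
    · exact (hsep S e₁ e₂ hS hv₁ fun h => hv ⟨fun _ => h, fun _ => hv₁⟩).elim
    · refine (hsep Sᶜ e₂ e₁ (fun a ha b hb hab => ?_) hv₁ fun h => ?_).elim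
      · rw [Sym2.eq_swap]
        exact (hS b (not_not.1 hb) a ha hab.symm).symm
      · exact hv ⟨fun h1 => absurd h1 hv₁, fun h2 => absurd h2 h⟩

end IsFlipConfiguration

end SimpleGraph

namespace SimpleGraph

variable {V : Type u} {G : SimpleGraph V}

/-! ### The ΔY operation -/

/-- A triangular face `a b c`, with the third neighbours `x`, `y`, `z` of its vertices. -/
structure IsTriangularFace (G : SimpleGraph V) (f : V → V → V) (a b c x y z : V) : Prop where
  adj_ab : G.Adj a b
  adj_bc : G.Adj b c
  adj_ca : G.Adj c a
  rot_a : f a c = b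
  rot_b : f b a = c
  rot_c : f c b = a
  rot_a' : f a b = x
  rot_b' : f b c = y
  rot_c' : f c a = z

/-- The contraction of a triangle to a vertex. -/
def contractTriangle [DecidableEq V] (a b c v : V) : Option {v : V // v ≠ a ∧ v ≠ b ∧ v ≠ c} :=
  if h : v ≠ a ∧ v ≠ b ∧ v ≠ c then some ⟨v, h⟩ else none

/-- The neighbour of `p` that a neighbour `q` of `p` after a ΔY operation comes from. -/
def liftNeighbor [DecidableEq V] (a b c x y p : V) :
    Option {v : V // v ≠ a ∧ v ≠ b ∧ v ≠ c} → V
  | some q => q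
  | none => if p = x then a else if p = y then b else c

/-- The rotation after a ΔY operation. -/
def deltaYRotation [DecidableEq V] (f : V → V → V) (a b c x y z : V) :
    Option {v : V // v ≠ a ∧ v ≠ b ∧ v ≠ c} → Option {v : V // v ≠ a ∧ v ≠ b ∧ v ≠ c} →
      Option {v : V // v ≠ a ∧ v ≠ b ∧ v ≠ c}
  | some p, q => contractTriangle a b c (f p (liftNeighbor a b c x y p q))
  | none, some q => contractTriangle a b c
      (if (q : V) = x then z else if (q : V) = y then x else y)
  | none, none => none

namespace IsTriangularFace

variable {f : V → V → V} {a b c x y z : V}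

theorem rotate (hT : G.IsTriangularFace f a b c x y z) : G.IsTriangularFace f b c a y z x :=
  ⟨hT.adj_bc, hT.adj_ca, hT.adj_ab, hT.rot_b, hT.rot_c, hT.rot_a, hT.rot_b', hT.rot_c', hT.rot_a'⟩

theorem rot_a'' (hf : G.IsCubicRotation f) (hT : G.IsTriangularFace f a b c x y z) :
    f a x = c := by
  have := hf.cube hT.adj_ca.symm
  rwa [hT.rot_a, hT.rot_a'] at this

theorem adj_a (hf : G.IsCubicRotation f) (hT : G.IsTriangularFace f a b c x y z) (w : V) :
    G.Adj a w ↔ w = c ∨ w = b ∨ w = x := by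
  rw [hf.adj_iff hT.adj_ca.symm, hT.rot_a, hT.rot_a']

theorem x_ne (hf : G.IsCubicRotation f) (hT : G.IsTriangularFace f a b c x y z) :
    x ≠ a ∧ x ≠ b ∧ x ≠ c := by
  have h1 : G.Adj a x := (hT.adj_a hf x).2 (by simp)
  have h2 := hf.ne hT.adj_ab
  have h3 := hf.ne' hT.adj_ca.symm
  rw [hT.rot_a'] at h2
  rw [hT.rot_a, hT.rot_a'] at h3
  exact ⟨h1.ne', h2, h3⟩

/-- If x = y, then {a, b, c, x} can be left only along cz and the third edge at x, although there is
a fifth vertex. -/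
theorem x_ne_y [Finite V] (hf : G.IsCubicRotation f) (hG : G.IsThreeEdgeConnected)
    (hT : G.IsTriangularFace f a b c x y z) (hV : 4 < Nat.card V) : x ≠ y := by
  classical
  rintro rfl
  have := Fintype.ofFinite V
  have ha := hT.adj_a hf
  have hb := hT.rotate.adj_a hf
  have hc := hT.rotate.rotate.adj_a hf
  have hxa : G.Adj x a := ((ha x).2 (by simp)).symm
  have hxb : G.Adj x b := ((hb x).2 (by simp)).symm
  obtain ⟨w, hw⟩ : ∃ w, ∀ v, G.Adj x v → v = a ∨ v = b ∨ v = w := by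
    have hab := hT.adj_ab.ne
    obtain ⟨p, q, r, -, -, -, h⟩ := hf.isCubic.exists_neighbors x
    rw [h] at hxa hxb
    simp only [h]
    rcases hxa with rfl | rfl | rfl <;> rcases hxb with rfl | rfl | rfl <;>
      first
      | exact absurd rfl hab
      | exact ⟨p, by tauto⟩
      | exact ⟨q, by tauto⟩
      | exact ⟨r, by tauto⟩
  have huniv : ∃ v, v ∉ ({a, b, c, x} : Finset V) := by
    by_contra! hall
    have h1 := Finset.eq_univ_of_forall hall
    have h2 := Finset.card_le_four (a := a) (b := b) (c := c) (d := x)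
    rw [h1, Finset.card_univ, ← Nat.card_eq_fintype_card] at h2
    omega
  obtain ⟨v, hv⟩ := huniv
  refine hG.false (S := {v | v ∈ ({a, b, c, x} : Finset V)}) (x := a) (y := v) s(c, z) s(x, w)
    (by simp) hv fun u hu t ht hut => ?_
  simp only [Finset.mem_insert, Finset.mem_singleton, Set.mem_ofPred_eq, not_or] at hu ht
  rcases hu with rfl | rfl | rfl | rfl
  · have := (ha t).1 hut
    tauto
  · have := (hb t).1 hut
    tauto
  · rcases (hc t).1 hut with h | h | h
    · exact absurd h ht.2.1
    · exact absurd h ht.1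
    · exact Or.inl (by rw [h])
  · rcases hw t hut with h | h | h
    · exact absurd h ht.1
    · exact absurd h ht.2.1
    · exact Or.inr (by rw [h])

section

variable [DecidableEq V]

theorem contractTriangle_of_ne {v : V} (h : v ≠ a ∧ v ≠ b ∧ v ≠ c) :
    contractTriangle a b c v = some ⟨v, h⟩ := dif_pos h

theorem contractTriangle_of_mem {v : V} (h : v = a ∨ v = b ∨ v = c) :
    contractTriangle a b c v = none := dif_neg (by tauto)

/-- As x, y, z are distinct, an outer vertex has at most one neighbour in the triangle, so no two
edges merge under the contraction. -/
theorem liftNeighbor_contractTriangle (hf : G.IsCubicRotation f)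
    (hT : G.IsTriangularFace f a b c x y z) (hxy : x ≠ y) (hyz : y ≠ z) (hzx : z ≠ x) {p w : V}
    (hp : p ≠ a ∧ p ≠ b ∧ p ≠ c) (hpw : G.Adj p w) :
    liftNeighbor a b c x y p (contractTriangle a b c w) = w := by
  by_cases hw : w ≠ a ∧ w ≠ b ∧ w ≠ c
  · rw [contractTriangle_of_ne hw, liftNeighbor]
  · have hw' : w = a ∨ w = b ∨ w = c := by tauto
    rw [contractTriangle_of_mem hw', liftNeighbor]
    rcases hw' with rfl | rfl | rfl
    · have := (hT.adj_a hf p).1 hpw.symm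
      rw [if_pos (by tauto)]
    · have := (hT.rotate.adj_a hf p).1 hpw.symm
      obtain rfl : p = y := by tauto
      rw [if_neg hxy.symm, if_pos rfl]
    · have := (hT.rotate.rotate.adj_a hf p).1 hpw.symm
      obtain rfl : p = z := by tauto
      rw [if_neg hzx, if_neg hyz.symm]

theorem deltaY_adj_contractTriangle {u v : V} (huv : G.Adj u v)
    (hne : contractTriangle a b c u ≠ contractTriangle a b c v) :
    (G.deltaY a b c).Adj (contractTriangle a b c u) (contractTriangle a b c v) := by
  by_cases hu : u ≠ a ∧ u ≠ b ∧ u ≠ c <;> by_cases hv : v ≠ a ∧ v ≠ b ∧ v ≠ c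
  · rw [contractTriangle_of_ne hu, contractTriangle_of_ne hv]
    exact huv
  · have hv' : v = a ∨ v = b ∨ v = c := by tauto
    rw [contractTriangle_of_ne hu, contractTriangle_of_mem hv']
    change G.Adj u a ∨ G.Adj u b ∨ G.Adj u c
    rcases hv' with rfl | rfl | rfl <;> simp [huv]
  · have hu' : u = a ∨ u = b ∨ u = c := by tauto
    rw [contractTriangle_of_ne hv, contractTriangle_of_mem hu']
    change G.Adj v a ∨ G.Adj v b ∨ G.Adj v c
    rcases hu' with rfl | rfl | rfl <;> simp [huv.symm]
  · rw [contractTriangle_of_mem (by tauto), contractTriangle_of_mem (by tauto)] at hne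
    exact absurd rfl hne

theorem exists_adj_of_deltaY_adj {p q : Option {v : V // v ≠ a ∧ v ≠ b ∧ v ≠ c}}
    (h : (G.deltaY a b c).Adj p q) :
    ∃ u v, G.Adj u v ∧ contractTriangle a b c u = p ∧ contractTriangle a b c v = q := by
  have hex : ∀ r : {v : V // v ≠ a ∧ v ≠ b ∧ v ≠ c},
      G.Adj r a ∨ G.Adj r b ∨ G.Adj r c → ∃ v, G.Adj r v ∧ contractTriangle a b c v = none := by
    rintro r (h | h | h)
    · exact ⟨a, h, contractTriangle_of_mem (by simp)⟩
    · exact ⟨b, h, contractTriangle_of_mem (by simp)⟩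
    · exact ⟨c, h, contractTriangle_of_mem (by simp)⟩
  rcases p with _ | p <;> rcases q with _ | q
  · exact absurd rfl h.ne
  · obtain ⟨v, hv, hv'⟩ := hex q h
    exact ⟨v, q, hv.symm, hv', contractTriangle_of_ne q.2⟩
  · obtain ⟨v, hv, hv'⟩ := hex p h
    exact ⟨p, v, hv, contractTriangle_of_ne p.2, hv'⟩
  · exact ⟨p, q, h, contractTriangle_of_ne p.2, contractTriangle_of_ne q.2⟩

variable (hf : G.IsCubicRotation f) (hT : G.IsTriangularFace f a b c x y z)
  (hxy : x ≠ y) (hyz : y ≠ z) (hzx : z ≠ x)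

include hf hT hxy hyz hzx

theorem isCubicRotation :
    (G.deltaY a b c).IsCubicRotation (deltaYRotation f a b c x y z) := by
  have hx := hT.x_ne hf
  have hy : y ≠ a ∧ y ≠ b ∧ y ≠ c := by have := hT.rotate.x_ne hf; tauto
  have hz : z ≠ a ∧ z ≠ b ∧ z ≠ c := by have := hT.rotate.rotate.x_ne hf; tauto
  refine isCubicRotation_of_cycles ?_
  rintro (_ | p)
  -- The cyclic order is x, z, y: the face that enters the triangle along xa continues along ac and
  -- leaves along cz.
  · refine ⟨some ⟨x, hx⟩, some ⟨z, hz⟩, some ⟨y, hy⟩, by simp [hzx.symm], by simp [hxy],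
      by simp [hyz.symm], ?_, ?_, ?_, ?_⟩
    · rintro (_ | ⟨w, hw⟩)
      · simp
      · have h1 := hT.adj_a hf w
        have h2 := hT.rotate.adj_a hf w
        have h3 := hT.rotate.rotate.adj_a hf w
        change (G.Adj w a ∨ G.Adj w b ∨ G.Adj w c) ↔ _
        simp only [G.adj_comm w, h1, h2, h3, Option.some.injEq, Subtype.mk.injEq]
        tauto
    · simp [deltaYRotation, contractTriangle_of_ne hz]
    · simp [deltaYRotation, contractTriangle_of_ne hy, hzx, hyz.symm]
    · simp [deltaYRotation, contractTriangle_of_ne hx, hxy.symm]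
  · obtain ⟨q, r, s, hqr, hqs, hrs, hadj, h1, h2, h3⟩ := hf.exists_cycle p
    have hlift : ∀ {w}, G.Adj p w → liftNeighbor a b c x y p (contractTriangle a b c w) = w :=
      fun hw => hT.liftNeighbor_contractTriangle hf hxy hyz hzx p.2 hw
    have hinj : ∀ {w w'}, G.Adj p w → G.Adj p w' → w ≠ w' →
        contractTriangle a b c w ≠ contractTriangle a b c w' := by
      intro w w' hw hw' hne h
      exact hne (by rw [← hlift hw, h, hlift hw'])
    have hq : G.Adj p q := (hadj q).2 (by simp)
    have hr : G.Adj p r := (hadj r).2 (by simp)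
    have hs : G.Adj p s := (hadj s).2 (by simp)
    refine ⟨_, _, _, hinj hq hr hqr, hinj hq hs hqs, hinj hr hs hrs, fun w => ⟨fun hw => ?_, ?_⟩,
      ?_, ?_, ?_⟩
    · obtain ⟨u, v, huv, hu, rfl⟩ := exists_adj_of_deltaY_adj hw
      obtain rfl : u = p := by
        by_cases hu' : u ≠ a ∧ u ≠ b ∧ u ≠ c
        · rw [contractTriangle_of_ne hu', Option.some.injEq] at hu
          rw [← hu]
        · rw [contractTriangle_of_mem (by tauto)] at hu
          exact absurd hu (by simp)
      rcases (hadj v).1 huv with rfl | rfl | rfl <;> simp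
    · have hp : contractTriangle a b c p = some p := contractTriangle_of_ne p.2
      have hmk : ∀ w, G.Adj p w → (G.deltaY a b c).Adj (some p) (contractTriangle a b c w) := by
        intro w hw
        rw [← hp]
        refine deltaY_adj_contractTriangle hw fun h => ?_
        rw [hp] at h
        have := hlift hw
        rw [← h] at this
        exact hw.ne this
      rintro (rfl | rfl | rfl)
      · exact hmk _ hq
      · exact hmk _ hr
      · exact hmk _ hs
    · simp only [deltaYRotation, hlift hq, h1]
    · simp only [deltaYRotation, hlift hr, h2]
    · simp only [deltaYRotation, hlift hs, h3]

/-- Edges of `G` not inside the triangle correspond one to one to edges of the result, so preimages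
of sets under the contraction have no larger boundary. -/
theorem isThreeEdgeConnected (hG : G.IsThreeEdgeConnected) :
    (G.deltaY a b c).IsThreeEdgeConnected := by
  set π := contractTriangle a b c with hπ
  have huniq : ∀ {u v u' v'}, G.Adj u v → G.Adj u' v' → π u = π u' → π v = π v' → π u ≠ π v →
      u = u' ∧ v = v' := by
    intro u v u' v' huv huv' hu hv hne
    have hmem : ∀ {w w'}, π w = π w' → (w ≠ a ∧ w ≠ b ∧ w ≠ c) → w = w' := by
      intro w w' h hw
      rw [hπ, contractTriangle_of_ne hw] at h
      by_cases hw' : w' ≠ a ∧ w' ≠ b ∧ w' ≠ c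
      · rw [contractTriangle_of_ne hw'] at h
        simpa using h
      · rw [contractTriangle_of_mem (by tauto)] at h
        exact absurd h (by simp)
    by_cases hu' : u ≠ a ∧ u ≠ b ∧ u ≠ c
    · obtain rfl := hmem hu hu'
      refine ⟨rfl, ?_⟩
      rw [← hT.liftNeighbor_contractTriangle hf hxy hyz hzx hu' huv, ← hπ, hv, hπ,
        hT.liftNeighbor_contractTriangle hf hxy hyz hzx hu' huv']
    · by_cases hv' : v ≠ a ∧ v ≠ b ∧ v ≠ c
      · obtain rfl := hmem hv hv'
        refine ⟨?_, rfl⟩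
        rw [← hT.liftNeighbor_contractTriangle hf hxy hyz hzx hv' huv.symm, ← hπ, hu, hπ,
          hT.liftNeighbor_contractTriangle hf hxy hyz hzx hv' huv'.symm]
      · rw [hπ, contractTriangle_of_mem (by tauto), contractTriangle_of_mem (by tauto)] at hne
        exact absurd rfl hne
  have hlift : ∀ e' : Sym2 (Option {v : V // v ≠ a ∧ v ≠ b ∧ v ≠ c}), ∃ e : Sym2 V, ∀ u v,
      G.Adj u v → π u ≠ π v → s(π u, π v) = e' → s(u, v) = e := by
    intro e'
    by_cases h : ∃ u v, G.Adj u v ∧ π u ≠ π v ∧ s(π u, π v) = e'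
    · obtain ⟨u, v, huv, hne, rfl⟩ := h
      refine ⟨s(u, v), fun u' v' huv' hne' heq => ?_⟩
      rcases Sym2.eq_iff.1 heq with ⟨h1, h2⟩ | ⟨h1, h2⟩
      · obtain ⟨rfl, rfl⟩ := huniq huv' huv h1 h2 hne'
        rfl
      · obtain ⟨rfl, rfl⟩ := huniq huv' huv.symm h1 h2 hne'
        exact Sym2.eq_swap
    · exact ⟨s(a, a), fun u v huv hne heq => absurd ⟨u, v, huv, hne, heq⟩ h⟩
  have hsurj : Function.Surjective π := by
    rintro (_ | p)
    · exact ⟨a, contractTriangle_of_mem (by simp)⟩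
    · exact ⟨p, contractTriangle_of_ne p.2⟩
  intro S e₁ e₂ hS
  obtain ⟨e₁', h₁⟩ := hlift e₁
  obtain ⟨e₂', h₂⟩ := hlift e₂
  rcases hG (π ⁻¹' S) e₁' e₂' (fun u hu v hv huv => by
    have hne : π u ≠ π v := fun h => hv (by rw [Set.mem_preimage, ← h]; exact hu)
    exact (hS (π u) hu (π v) hv (deltaY_adj_contractTriangle huv hne)).imp
      (h₁ u v huv hne) (h₂ u v huv hne)) with h | h
  · left
    rw [← Set.image_preimage_eq S hsurj, h, Set.image_empty]
  · right
    rw [← Set.image_preimage_eq S hsurj, h, Set.image_univ, hsurj.range_eq]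

/-- The cochain is pulled back along the contraction, with value zero on the triangle; its potential
is then constant on the triangle and descends. -/
theorem isAcyclicRotation (hac : G.IsAcyclicRotation f) :
    (G.deltaY a b c).IsAcyclicRotation (deltaYRotation f a b c x y z) := by
  have hx := hT.x_ne hf
  have hy : y ≠ a ∧ y ≠ b ∧ y ≠ c := by have := hT.rotate.x_ne hf; tauto
  have hz : z ≠ a ∧ z ≠ b ∧ z ≠ c := by have := hT.rotate.rotate.x_ne hf; tauto
  have hab := hT.adj_ab.ne
  have hbc := hT.adj_bc.ne
  have hca := hT.adj_ca.ne
  intro h' hh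
  set π := contractTriangle a b c with hπ
  set f' := deltaYRotation f a b c x y z with hf'
  have hin : ∀ {v}, v = a ∨ v = b ∨ v = c → π v = none := fun h => contractTriangle_of_mem h
  let T : V → Prop := fun v => v = a ∨ v = b ∨ v = c
  have ha0 : π a = none := hin (Or.inl rfl)
  have hb0 : π b = none := hin (Or.inr (Or.inl rfl))
  have hc0 : π c = none := hin (Or.inr (Or.inr rfl))
  have hnT : ∀ {v}, ¬ T v → v ≠ a ∧ v ≠ b ∧ v ≠ c := fun {v} h => by
    simpa [T, not_or] using h
  -- The darts ac, cb, ba lie on the neighbouring faces and copy the value of their successors cz,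
  -- by, ax; the darts on the triangular face itself get 0.
  let h : V → V → ZMod 2 := fun u v =>
    if T u ∧ T v then
      if u = a ∧ v = c then h' none (π z) else if u = c ∧ v = b then h' none (π y)
      else if u = b ∧ v = a then h' none (π x) else 0
    else h' (π u) (π v)
  have hout : ∀ {u v}, ¬ (T u ∧ T v) → h u v = h' (π u) (π v) := fun hn => if_neg hn
  have hac' : h a c = h' none (π z) := by simp [h, T]
  have hcb' : h c b = h' none (π y) := by simp [h, T, hca]
  have hba' : h b a = h' none (π x) := by simp [h, T, hab.symm, hbc]
  have hab' : h a b = 0 := by simp [h, T, hbc, hca.symm, hab]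
  have hbc' : h b c = 0 := by simp [h, T, hbc, hca, hab.symm]
  have hca' : h c a = 0 := by simp [h, T, hca, hbc.symm, hab]
  have hTx : ¬ T x := by simp [T, hx]
  have hTy : ¬ T y := by simp [T, hy]
  have hTz : ¬ T z := by simp [T, hz]
  have hM : ∀ u v, G.Adj u v → ¬ (T u ∧ T v) →
      h u v + h v (f v u) = h' (π u) (π v) + h' (π v) (f' (π v) (π u)) := by
    intro u v huv hn
    rw [hout hn]
    congr 1
    by_cases hv : T v
    · have hu : ¬ T u := fun hu => hn ⟨hu, hv⟩
      have hπv : π v = none := hin hv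
      have hπu : π u = some ⟨u, hnT hu⟩ := contractTriangle_of_ne (hnT hu)
      rw [hπv, hπu]
      have hcase : (v = a ∧ u = x) ∨ (v = b ∧ u = y) ∨ (v = c ∧ u = z) := by
        have hu' := hnT hu
        rcases hv with rfl | rfl | rfl
        · have := (hT.adj_a hf u).1 huv.symm
          tauto
        · have := (hT.rotate.adj_a hf u).1 huv.symm
          tauto
        · have := (hT.rotate.rotate.adj_a hf u).1 huv.symm
          tauto
      rcases hcase with ⟨rfl, rfl⟩ | ⟨rfl, rfl⟩ | ⟨rfl, rfl⟩
      · rw [hT.rot_a'' hf, hac']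
        simp [hf', deltaYRotation, hπ]
      · rw [hT.rotate.rot_a'' hf, hba']
        simp [hf', deltaYRotation, hπ, hxy.symm]
      · rw [hT.rotate.rotate.rot_a'' hf, hcb']
        simp [hf', deltaYRotation, hπ, hzx, hyz.symm]
    · have hπv : π v = some ⟨v, hnT hv⟩ := contractTriangle_of_ne (hnT hv)
      rw [hout (fun h => hv h.1), hπv, hf', deltaYRotation, hπ,
        hT.liftNeighbor_contractTriangle hf hxy hyz hzx (hnT hv) huv.symm]
  have hM0 : ∀ u v, G.Adj u v → T u → T v → h u v + h v (f v u) = 0 := by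
    intro u v huv hu hv
    rcases hu with rfl | rfl | rfl <;> rcases hv with rfl | rfl | rfl
    · exact absurd rfl huv.ne
    · rw [hT.rot_b, hab', hbc', add_zero]
    · rw [hT.rot_c', hac', hout (fun h => hTz h.2), hc0, CharTwo.add_self_eq_zero]
    · rw [hT.rot_a', hba', hout (fun h => hTx h.2), ha0, CharTwo.add_self_eq_zero]
    · exact absurd rfl huv.ne
    · rw [hT.rot_c, hbc', hca', add_zero]
    · rw [hT.rot_a, hca', hab', add_zero]
    · rw [hT.rot_b', hcb', hout (fun h => hTy h.2), hb0, CharTwo.add_self_eq_zero]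
    · exact absurd rfl huv.ne
  have hne : ∀ {u v}, G.Adj u v → ¬ (T u ∧ T v) → π u ≠ π v := by
    intro u v huv hn heq
    by_cases hu : T u
    · have hv : ¬ T v := fun hv => hn ⟨hu, hv⟩
      rw [hin hu, hπ, contractTriangle_of_ne (hnT hv)] at heq
      exact absurd heq (by simp)
    · by_cases hv : T v
      · rw [hin hv, hπ, contractTriangle_of_ne (hnT hu)] at heq
        exact absurd heq (by simp)
      · rw [hπ, contractTriangle_of_ne (hnT hu), contractTriangle_of_ne (hnT hv)] at heq
        exact huv.ne (by simpa using heq)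
  obtain ⟨φ, hφ⟩ := hac h (by
    intro u v huv
    by_cases hn : T u ∧ T v
    · rw [hM0 u v huv hn.1 hn.2, hM0 v u huv.symm hn.2 hn.1]
    · rw [hM u v huv hn, hM v u huv.symm fun h => hn h.symm]
      exact hh _ _ (deltaY_adj_contractTriangle huv (hne huv hn)))
  have hφ0 : ∀ u, T u → φ u = φ a := by
    have hb : φ b = φ a := (CharTwo.add_eq_zero.1 ((hφ a b hT.adj_ab).symm.trans
      (hM0 a b hT.adj_ab (by simp [T]) (by simp [T])))).symm
    have hc : φ c = φ a := CharTwo.add_eq_zero.1 ((hφ c a hT.adj_ca).symm.trans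
      (hM0 c a hT.adj_ca (by simp [T]) (by simp [T])))
    rintro u (rfl | rfl | rfl)
    · rfl
    · exact hb
    · exact hc
  let φ' : Option {v : V // v ≠ a ∧ v ≠ b ∧ v ≠ c} → ZMod 2 := fun p =>
    p.elim (φ a) fun v => φ v
  have hφ' : ∀ v, φ' (π v) = φ v := by
    intro v
    by_cases hv : T v
    · rw [hin hv, hφ0 v hv]
      rfl
    · rw [hπ, contractTriangle_of_ne (hnT hv)]
      rfl
  refine ⟨φ', fun p q hpq => ?_⟩
  obtain ⟨u, v, huv, rfl, rfl⟩ := exists_adj_of_deltaY_adj hpq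
  have hn : ¬ (T u ∧ T v) := fun hn => hpq.ne ((hin hn.1).trans (hin hn.2).symm)
  rw [hφ', hφ', ← hφ u v huv, hM u v huv hn]

end

end IsTriangularFace

end SimpleGraph

namespace SimpleGraph

variable {V : Type u} {G : SimpleGraph V}

/-! ### Boundary walks of faces -/

/-- A boundary walk of a face, repeated periodically. -/
structure IsFaceWalk (G : SimpleGraph V) (f : V → V → V) (x : ℕ → V) : Prop where
  adj : ∀ i, G.Adj (x i) (x (i + 1))
  step : ∀ i, f (x (i + 1)) (x i) = x (i + 2)

theorem IsCubicRotation.exists_isFaceWalk {f : V → V → V} (hf : G.IsCubicRotation f) {u v : V}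
    (huv : G.Adj u v) : ∃ x, G.IsFaceWalk f x ∧ x 0 = u ∧ x 1 = v := by
  let y : ℕ → V × V := fun i => (fun p : V × V => (p.2, f p.2 p.1))^[i] (u, v)
  have hy : ∀ i, y (i + 1) = ((y i).2, f (y i).2 (y i).1) := fun i =>
    Function.iterate_succ_apply' _ _ _
  have hadj : ∀ i, G.Adj (y i).1 (y i).2 := by
    intro i
    induction i with
    | zero => exact huv
    | succ i ih =>
      rw [hy]
      exact hf.adj ih.symm
  refine ⟨fun i => (y i).1, ⟨fun i => ?_, fun i => ?_⟩, rfl, rfl⟩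
  · simp only [hy i]
    exact hadj i
  · simp only [hy (i + 1), hy i]

namespace IsFaceWalk

variable {f : V → V → V} {x : ℕ → V}

theorem shift (hx : G.IsFaceWalk f x) (n : ℕ) : G.IsFaceWalk f fun i => x (n + i) :=
  ⟨fun i => hx.adj (n + i), fun i => hx.step (n + i)⟩

theorem eq_add (hx : G.IsFaceWalk f x) {i j : ℕ} (h₀ : x i = x j) (h₁ : x (i + 1) = x (j + 1))
    (n : ℕ) : x (i + n) = x (j + n) := by
  suffices h : x (i + n) = x (j + n) ∧ x (i + n + 1) = x (j + n + 1) from h.1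
  induction n with
  | zero => exact ⟨h₀, h₁⟩
  | succ n ih =>
    refine ⟨ih.2, ?_⟩
    have h1 := hx.step (i + n)
    have h2 := hx.step (j + n)
    rw [ih.1, ih.2, h2] at h1
    exact h1.symm

theorem eq_of_add_eq (hf : G.IsCubicRotation f) (hx : G.IsFaceWalk f x) {i j : ℕ} (n : ℕ)
    (h₀ : x (i + n) = x (j + n)) (h₁ : x (i + n + 1) = x (j + n + 1)) :
    x i = x j ∧ x (i + 1) = x (j + 1) := by
  induction n with
  | zero => exact ⟨h₀, h₁⟩
  | succ n ih =>
    refine ih ?_ h₀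
    have h1 := hx.step (i + n)
    have h2 := hx.step (j + n)
    have a1 := (hx.adj (i + n)).symm
    have a2 := (hx.adj (j + n)).symm
    rw [← add_assoc, ← add_assoc] at h₀ h₁
    rw [h₀] at h1 a1
    refine hf.inj a1 a2 (h1.trans (Eq.trans h₁ h2.symm))

/-- The darts strictly after x₀ → x₁, up to and including the first x₁ → x₀, form a segment of the
face. The coboundary of its indicator along the face is nonzero only at these two darts, so it is a
cochain supported on the single edge x₀x₁. By acyclicity it is δφ, and the level set of φ exhibits
x₀x₁ as a bridge. -/
theorem not_reverse_zero (hf : G.IsPlanarCubicMap f) (hx : G.IsFaceWalk f x) (j : ℕ) :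
    ¬ (x j = x 1 ∧ x (j + 1) = x 0) := by
  classical
  intro hj
  have hex : ∃ j, x j = x 1 ∧ x (j + 1) = x 0 := ⟨j, hj⟩
  clear hj j
  obtain ⟨j, hj, hmin⟩ : ∃ j, (x j = x 1 ∧ x (j + 1) = x 0) ∧
      ∀ i < j, ¬ (x i = x 1 ∧ x (i + 1) = x 0) :=
    ⟨Nat.find hex, Nat.find_spec hex, fun i hi => Nat.find_min hex hi⟩
  have h01 : x 0 ≠ x 1 := (hx.adj 0).ne
  have hj0 : 1 ≤ j := by
    rcases Nat.eq_zero_or_pos j with rfl | h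
    · exact absurd hj.1 h01
    · exact h
  -- A return to x₀ → x₁ before the reversal could be cut off, giving an earlier reversal.
  have hret : ∀ i, 1 ≤ i → i ≤ j → ¬ (x i = x 0 ∧ x (i + 1) = x 1) := by
    rintro i hi hij ⟨h0, h1⟩
    have e1 := hx.eq_add (i := i) (j := 0) h0 (by simpa using h1) (j - i)
    have e2 := hx.eq_add (i := i) (j := 0) h0 (by simpa using h1) (j - i + 1)
    rw [zero_add] at e1 e2
    rw [show i + (j - i) = j by omega] at e1
    rw [show i + (j - i + 1) = j + 1 by omega] at e2
    exact hmin (j - i) (by omega) ⟨e1.symm.trans hj.1, e2.symm.trans hj.2⟩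
  let P : V → V → Prop := fun u v => ∃ i, 1 ≤ i ∧ i ≤ j ∧ x i = u ∧ x (i + 1) = v
  let h : V → V → ZMod 2 := fun u v => if P u v then 1 else 0
  have hT : ∀ {u v}, P u v → h u v = 1 := fun h => if_pos h
  have hF : ∀ {u v}, ¬ P u v → h u v = 0 := fun h => if_neg h
  have hM : ∀ u v, G.Adj u v →
      h u v + h v (f v u) = if s(u, v) = s(x 0, x 1) then 1 else 0 := by
    intro u v huv
    split_ifs with he
    · rcases Sym2.eq_iff.1 he with ⟨rfl, rfl⟩ | ⟨rfl, rfl⟩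
      · rw [hF (fun ⟨i, hi, hij, h0, h1⟩ => hret i hi hij ⟨h0, h1⟩), hT, zero_add]
        exact ⟨1, le_rfl, hj0, rfl, (hx.step 0).symm⟩
      · rw [hT ⟨j, hj0, le_rfl, hj.1, hj.2⟩, hF, add_zero]
        rintro ⟨i, hi, hij, h0, h1⟩
        have hs := hx.step j
        rw [hj.1, hj.2] at hs
        have := hx.eq_of_add_eq hf.rot (i := j + 1 - i) (j := 0) i
          (by rw [show j + 1 - i + i = j + 1 by omega, zero_add, h0, hj.2])
          (by rw [show j + 1 - i + i + 1 = j + 2 by omega, zero_add, h1, hs])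
        exact hret (j + 1 - i) (by omega) (by omega) (by simpa using this)
    · have hiff : P u v ↔ P v (f v u) := by
        constructor
        · rintro ⟨i, hi, hij, rfl, rfl⟩
          have hne : i ≠ j := by
            rintro rfl
            exact he (by rw [hj.1, hj.2, Sym2.eq_swap])
          exact ⟨i + 1, by omega, by omega, rfl, (hx.step i).symm⟩
        · rintro ⟨i, hi, hij, rfl, h1⟩
          obtain ⟨i, rfl⟩ : ∃ m, i = m + 1 := ⟨i - 1, by omega⟩
          have hu : x i = u := by
            refine hf.rot.inj (hx.adj i).symm huv.symm ?_
            rw [hx.step i, ← h1]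
          subst hu
          rcases Nat.eq_zero_or_pos i with rfl | hi0
          · exact absurd rfl he
          · exact ⟨i, hi0, by omega, rfl, rfl⟩
      simp only [h, hiff]
      exact CharTwo.add_self_eq_zero _
  obtain ⟨φ, hφ⟩ := hf.acyclic h fun u v huv => by
    rw [hM u v huv, hM v u huv.symm, Sym2.eq_swap]
  refine hf.conn.false (S := {v | φ v = φ (x 0)}) (x := x 0) (y := x 1) s(x 0, x 1) s(x 0, x 1)
    rfl (fun h1 => ?_) fun a ha b hb hab => ?_
  · have := hφ _ _ (hx.adj 0)
    rw [hM _ _ (hx.adj 0), zero_add, if_pos rfl, show φ (x 1) = φ (x 0) from h1,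
      CharTwo.add_self_eq_zero] at this
    exact one_ne_zero this
  · have := hφ _ _ hab
    rw [hM _ _ hab] at this
    split_ifs at this with he
    · exact Or.inl he
    · exact absurd ((CharTwo.add_eq_zero.1 this.symm).symm.trans ha) hb

theorem not_reverse (hf : G.IsPlanarCubicMap f) (hx : G.IsFaceWalk f x) (i j : ℕ) :
    ¬ (x j = x (i + 1) ∧ x (j + 1) = x i) := by
  rintro ⟨h0, h1⟩
  rcases le_total i j with hij | hij
  · refine (hx.shift i).not_reverse_zero hf (j - i) ⟨?_, ?_⟩
    · rw [show i + (j - i) = j by omega]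
      exact h0
    · rw [show i + (j - i + 1) = j + 1 by omega]
      exact h1
  · refine (hx.shift j).not_reverse_zero hf (i - j) ⟨?_, ?_⟩
    · rw [show j + (i - j) = i by omega]
      exact h1.symm
    · rw [show j + (i - j + 1) = i + 1 by omega]
      exact h0.symm

/-- Two different passages of a face through a cubic vertex share an edge there, entered by one and
left by the other; this is a reversal. -/
theorem eq_of_vertex_eq (hf : G.IsPlanarCubicMap f) (hx : G.IsFaceWalk f x) {i j : ℕ}
    (h : x (i + 1) = x (j + 1)) : x i = x j := by
  have h1 := hx.adj i
  have h2 := hx.adj j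
  have s1 := hx.step i
  have s2 := hx.step j
  rw [h] at h1 s1
  rcases hf.rot.mem h1.symm h2.symm with h3 | h3 | h3
  · exact h3.symm
  · rw [s1] at h3
    exact absurd ⟨h3, h.symm⟩ (hx.not_reverse hf (i + 1) j)
  · rw [h3, hf.rot.cube h1.symm] at s2
    exact absurd ⟨h.symm, s2.symm⟩ (hx.not_reverse hf i (j + 1))

theorem exists_period [Finite V] (hf : G.IsCubicRotation f) (hx : G.IsFaceWalk f x) :
    ∃ k, 0 < k ∧ ∀ i, x (i + k) = x i := by
  obtain ⟨i, j, hne, h⟩ := Finite.exists_ne_map_eq_of_infinite fun i => (x i, x (i + 1))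
  wlog hij : i < j generalizing i j
  · exact this j i hne.symm h.symm (by omega)
  rw [Prod.mk.injEq] at h
  have h0 := hx.eq_of_add_eq hf (i := 0) (j := j - i) i
    (by rw [zero_add, Nat.sub_add_cancel hij.le, h.1])
    (by rw [zero_add, Nat.sub_add_cancel hij.le, h.2])
  refine ⟨j - i, by omega, fun n => ?_⟩
  have := hx.eq_add h0.1 h0.2 n
  rw [zero_add] at this
  rw [this, add_comm]

theorem ne_of_lt (hf : G.IsPlanarCubicMap f) (hx : G.IsFaceWalk f x) {k : ℕ}
    (hper : ∀ i, x (i + k) = x i)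
    (hmin : ∀ i j, i < j → j < i + k → ¬ (x i = x j ∧ x (i + 1) = x (j + 1))) {i j : ℕ}
    (hij : i < j) (hjk : j < i + k) : x i ≠ x j := by
  intro h
  -- Predecessors of `x i` and `x j` are taken one period later, which avoids the index i - 1.
  obtain ⟨m, hm⟩ : ∃ m, k = m + 1 := ⟨k - 1, by omega⟩
  have h1 : x (i + m + 1) = x (j + m + 1) := by
    rw [add_assoc, add_assoc, ← hm, hper, hper, h]
  exact hmin (i + m) (j + m) (by omega) (by omega) ⟨hx.eq_of_vertex_eq hf h1, h1⟩

theorem rot_rot (hf : G.IsCubicRotation f) (hx : G.IsFaceWalk f x) (i : ℕ) :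
    f (x (i + 1)) (f (x (i + 1)) (x (i + 2))) = x i := by
  rw [← hx.step i]
  exact hf.cube (hx.adj i).symm

theorem adj_iff (hf : G.IsCubicRotation f) (hx : G.IsFaceWalk f x) (i : ℕ) (w : V) :
    G.Adj (x (i + 1)) w ↔ w = x i ∨ w = x (i + 2) ∨ w = f (x (i + 1)) (x (i + 2)) := by
  rw [hf.adj_iff (hx.adj i).symm, hx.step]

/-- A chord can not join `x₁` and `x₃` in such a way that `x₃` follows `x₂` around `x₁`. -/
theorem rot_ne (hf : G.IsPlanarCubicMap f) (hx : G.IsFaceWalk f x) (h14 : x 1 ≠ x 4) :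
    f (x 1) (x 2) ≠ x 3 := by
  intro h
  have h13 : G.Adj (x 3) (x 1) := by
    rw [← h]
    exact (hf.rot.adj (hx.adj 1)).symm
  have hrot : f (x 3) (x 1) = x 2 := by
    rcases (hx.adj_iff hf.rot 2 (x 1)).1 h13 with h1 | h1 | h1
    · exact absurd h1 (hx.adj 1).ne
    · exact absurd h1 h14
    · rw [h1, hx.rot_rot hf.rot 2]
  have hadj : G.Adj (x 2) (f (x 2) (x 3)) := hf.rot.adj (hx.adj 2)
  -- With w the third neighbour of x₂, the face across x₁x₂ would read w, x₂, x₁, x₃, x₂, w and use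
  -- the edge wx₂ in both directions.
  obtain ⟨y, hy, hy0, hy1⟩ := hf.rot.exists_isFaceWalk hadj.symm
  have hy2 : y 2 = x 1 := by
    rw [← hy.step 0, zero_add, hy0, hy1]
    exact hx.rot_rot hf.rot 1
  have hy3 : y 3 = x 3 := by rw [← hy.step 1, hy1, hy2, h]
  have hy4 : y 4 = x 2 := by rw [← hy.step 2, hy2, hy3, hrot]
  have hy5 : y 5 = y 0 := by rw [← hy.step 3, hy3, hy4, hy0]
  exact hy.not_reverse hf 0 4 ⟨by rw [hy4, hy1], hy5⟩

/-- Uncrossing: T ∪ T' has at least three boundary edges, one of them other than x₀x₁ and x₃x₄, and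
this uses up `e` or `e'`. What remains for T ∩ T' is x₁x₂, x₂x₃ and one more edge; removing x₂
leaves a cut of at most two edges around the third neighbour of x₂. -/
theorem not_isObstructingCut_and (hf : G.IsPlanarCubicMap f) (hx : G.IsFaceWalk f x)
    (h03 : x 0 ≠ x 3) {T T' : Set V} {e e' : Sym2 V}
    (hT : G.IsObstructingCut (x 1) (x 2) (x 0) (f (x 1) (x 2)) (x 3) (f (x 2) (x 3)) T e)
    (hT' : G.IsObstructingCut (x 2) (x 3) (x 1) (f (x 2) (x 3)) (x 4) (f (x 3) (x 4)) T' e') :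
    False := by
  obtain ⟨⟨t1, t2, ty1, ty2, t0, t3⟩, hδ⟩ := hT
  obtain ⟨⟨t2', t3', ty2', ty3', t1', t4'⟩, hδ'⟩ := hT'
  have a2 : G.Adj (x 2) (f (x 2) (x 3)) := hf.rot.adj (hx.adj 2)
  have n2 := hx.adj_iff hf.rot 1
  have n3 := hx.adj_iff hf.rot 2
  have h34 := hx.adj 3
  have h24 : x 2 ≠ x 4 := by
    have := hf.rot.ne (hx.adj 2).symm
    rw [hx.step 2] at this
    exact this.symm
  norm_num only at n2 n3 h34
  -- Otherwise x₃x₄ is `e`, and T ∪ {x₃} is bounded by x₀x₁ and the third edge at x₃ alone.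
  have t4 : x 4 ∉ T := by
    intro t4
    have he : s(x 4, x 3) = e := by
      rcases hδ _ t4 _ t3 h34.symm with h | h | h
      · rw [Sym2.eq_iff] at h
        grind only
      · rw [Sym2.eq_iff] at h
        grind only
      · exact h
    refine hf.conn.false (S := T ∪ {x 3}) (x := x 3) (y := x 0) s(x 0, x 1)
      s(x 3, f (x 3) (x 4)) (Or.inr rfl) (fun h => h.elim t0 h03) fun a ha b hb hab => ?_
    have hb1 : b ∉ T := fun h => hb (Or.inl h)
    have hb2 : b ≠ x 3 := fun h => hb (Or.inr h)
    rcases ha with ha | rfl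
    · have h := hδ a ha b hb1 hab
      rw [← he] at h
      refine Or.inl (h.resolve_right ?_)
      simp only [Sym2.eq_iff]
      grind only
    · rcases (n3 b).1 hab with rfl | rfl | rfl
      · exact absurd t2 hb1
      · exact absurd t4 hb1
      · exact Or.inr rfl
  obtain ⟨a, ha, b, hb, hab, hab1, hab2⟩ : ∃ a ∈ T ∪ T', ∃ b ∉ T ∪ T', G.Adj a b ∧
      s(a, b) ≠ s(x 0, x 1) ∧ s(a, b) ≠ s(x 3, x 4) := by
    by_contra! hcon
    refine hf.conn.false (S := T ∪ T') (x := x 1) (y := x 4) s(x 0, x 1) s(x 3, x 4) (Or.inl t1)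
      (fun h => h.elim t4 t4') fun a ha b hb hab => ?_
    exact or_iff_not_imp_left.2 (hcon a ha b hb hab)
  have hbT : b ∉ T := fun h => hb (Or.inl h)
  have hbT' : b ∉ T' := fun h => hb (Or.inr h)
  have hI₁ : ∀ p ∈ T, p ∈ T' → ∀ q ∉ T, G.Adj p q → s(p, q) = s(x 2, x 3) ∨ s(p, q) = e := by
    intro p hp hp' q hq hpq
    refine (hδ p hp q hq hpq).resolve_left ?_
    rw [Sym2.eq_iff]
    grind only
  have hI₂ : ∀ p ∈ T, p ∈ T' → ∀ q ∉ T', G.Adj p q →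
      s(p, q) = s(x 1, x 2) ∨ s(p, q) = e' := by
    intro p hp hp' q hq hpq
    have := hδ' p hp' q hq hpq
    refine this.imp id fun h => h.resolve_left ?_
    rw [Sym2.eq_iff]
    grind only
  -- The edge ab ends outside both sets and so cannot leave T ∩ T' towards T ∪ T'. If it is `e`,
  -- then g = `e'`, and vice versa.
  obtain ⟨g, hg⟩ : ∃ g, ∀ p ∈ T, p ∈ T' → ∀ q, (q ∉ T ∨ q ∉ T') → G.Adj p q →
      s(p, q) = s(x 1, x 2) ∨ s(p, q) = s(x 2, x 3) ∨ s(p, q) = g := by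
    rcases ha with ha | ha
    · have hae : s(a, b) = e := by
        rcases hδ a ha b hbT hab with h | h | h
        · exact absurd h hab1
        · rw [Sym2.eq_iff] at h
          grind only
        · exact h
      refine ⟨e', fun p hp hp' q hq hpq => ?_⟩
      by_cases hqT' : q ∈ T'
      · have hqT : q ∉ T := hq.resolve_right fun h => h hqT'
        rcases hI₁ p hp hp' q hqT hpq with h | h
        · exact Or.inr (Or.inl h)
        · rw [← hae, Sym2.eq_iff] at h
          grind only
      · exact (hI₂ p hp hp' q hqT' hpq).imp id Or.inr
    · have hae : s(a, b) = e' := by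
        rcases hδ' a ha b hbT' hab with h | h | h
        · rw [Sym2.eq_iff] at h
          grind only
        · exact absurd h hab2
        · exact h
      refine ⟨e, fun p hp hp' q hq hpq => ?_⟩
      by_cases hqT : q ∈ T
      · have hqT' : q ∉ T' := hq.resolve_left fun h => h hqT
        rcases hI₂ p hp hp' q hqT' hpq with h | h
        · exact Or.inl h
        · rw [← hae, Sym2.eq_iff] at h
          grind only
      · exact Or.inr (hI₁ p hp hp' q hqT hpq)
  refine hf.conn.false (S := (T ∩ T') \ {x 2}) (x := f (x 2) (x 3)) (y := x 2)
    s(x 2, f (x 2) (x 3)) g ⟨⟨ty2, ty2'⟩, a2.ne'⟩ (fun h => h.2 rfl) ?_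
  rintro p ⟨⟨hp, hp'⟩, hp2⟩ q hq hpq
  rw [Set.mem_singleton_iff] at hp2
  by_cases hq2 : q = x 2
  · subst hq2
    rcases (n2 p).1 hpq.symm with rfl | rfl | rfl
    · exact absurd hp' t1'
    · exact absurd hp t3
    · exact Or.inl Sym2.eq_swap
  · have hq' : q ∉ T ∨ q ∉ T' := by
      by_contra! h
      exact hq ⟨h, hq2⟩
    have := hg p hp hp' q hq' hpq
    rw [Sym2.eq_iff, Sym2.eq_iff] at this
    grind only

theorem isFlipConfiguration (hf : G.IsPlanarCubicMap f) (hx : G.IsFaceWalk f x)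
    (h03 : x 0 ≠ x 3) (h14 : x 1 ≠ x 4)
    (hT : ∀ T e, ¬ G.IsObstructingCut (x 1) (x 2) (x 0) (f (x 1) (x 2)) (x 3)
      (f (x 2) (x 3)) T e) :
    G.IsFlipConfiguration f (x 1) (x 2) (x 0) (f (x 1) (x 2)) (x 3) (f (x 2) (x 3)) where
  adj := hx.adj 1
  rot₁ := hx.step 0
  rot₁' := rfl
  rot₁'' := hx.rot_rot hf.rot 0
  rot₂ := hx.step 1
  rot₂' := rfl
  rot₂'' := hx.rot_rot hf.rot 1
  ne₁₃ := h03
  ne₂₃ := hx.rot_ne hf h14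
  ne₂₄ := by
    intro heq
    have n1 := hx.adj_iff hf.rot 0
    have n2 := hx.adj_iff hf.rot 1
    norm_num only at n1 n2
    rw [heq] at n1
    have a1 : G.Adj (x 1) (f (x 2) (x 3)) := (n1 _).2 (by simp)
    have a2 : G.Adj (x 2) (f (x 2) (x 3)) := (n2 _).2 (by simp)
    set w := f (x 2) (x 3) with hw
    have hw0 : x 0 ≠ w := by
      have h1 := hx.rot_rot hf.rot 0
      norm_num only at h1
      rw [heq] at h1
      intro h
      have := hf.rot.ne a1
      rw [h1] at this
      exact this h
    have hw3 : x 3 ≠ w := (hf.rot.ne (hx.adj 2)).symm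
    have h02 : x 0 ≠ x 2 := by
      have := hf.rot.ne (hx.adj 0).symm
      rw [hx.step 0] at this
      exact this.symm
    have h13 : x 1 ≠ x 3 := by
      have := hf.rot.ne (hx.adj 1).symm
      rw [hx.step 1] at this
      exact this.symm
    have h01 := (hx.adj 0).ne
    have h12 := (hx.adj 1).ne
    have h23 := (hx.adj 2).ne
    norm_num only at h01 h12 h23
    obtain ⟨t, ht⟩ : ∃ t, ∀ v, G.Adj w v → v = x 1 ∨ v = x 2 ∨ v = t := by
      obtain ⟨p, q, r, -, -, -, h⟩ := hf.rot.isCubic.exists_neighbors w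
      have b1 := (h _).1 a1.symm
      have b2 := (h _).1 a2.symm
      simp only [h]
      rcases b1 with b1 | b1 | b1 <;> rcases b2 with b2 | b2 | b2 <;>
        first
        | exact absurd (b1.trans b2.symm) h12
        | exact ⟨p, by rw [b1, b2]; tauto⟩
        | exact ⟨q, by rw [b1, b2]; tauto⟩
        | exact ⟨r, by rw [b1, b2]; tauto⟩
    -- If x₁ and x₂ have a common third neighbour w, the triangle x₁x₂w itself is bounded by an
    -- obstructing cut.
    refine hT {x 1, x 2, w} s(w, t) ⟨⟨by simp, by simp, by simp [heq], by simp, ?_, ?_⟩, ?_⟩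
    · simp [h01, h02, hw0]
    · simp [h13.symm, h23.symm, hw3]
    · intro a ha b hb hab
      simp only [Set.mem_insert_iff, Set.mem_singleton_iff, not_or] at ha hb
      rcases ha with rfl | rfl | rfl
      · rcases (n1 b).1 hab with rfl | rfl | rfl
        · exact Or.inl Sym2.eq_swap
        · exact absurd rfl hb.2.1
        · exact absurd rfl hb.2.2
      · rcases (n2 b).1 hab with rfl | rfl | rfl
        · exact absurd rfl hb.1
        · exact Or.inr (Or.inl rfl)
        · exact absurd rfl hb.2.2
      · rcases ht b hab with rfl | rfl | rfl
        · exact absurd rfl hb.1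
        · exact absurd rfl hb.2.1
        · exact Or.inr (Or.inr rfl)

end IsFaceWalk

end SimpleGraph

namespace SimpleGraph

variable {V : Type u} {G : SimpleGraph V}

/-! ### Reduction to the complete graph on four vertices -/

/-- The new walk is x₁, x₃, x₄, …, x_k = x₀, and then x₁ again; distinctness of the vertices keeps
the renaming from interfering except at x₃. -/
theorem IsFaceWalk.exists_shorter {f : V → V → V} {x : ℕ → V} {k : ℕ} [DecidableEq V]
    (hf : G.IsCubicRotation f) (hx : G.IsFaceWalk f x) (hk : 4 ≤ k)
    (hper : ∀ i, x (i + k) = x i) (hne : ∀ i j, i < j → j < i + k → x i ≠ x j)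
    {u₂ u₄ : V} (hF : G.IsFlipConfiguration f (x 1) (x 2) (x 0) u₂ (x 3) u₄) :
    ∃ y, (G.contractElongate (x 1) (x 2) u₂ (x 3)).IsFaceWalk
      (flipRotation f (x 1) (x 2) (x 0) u₂ (x 3) u₄) y ∧ ∀ i, y (i + (k - 1)) = y i := by
  set f' := flipRotation f (x 1) (x 2) (x 0) u₂ (x 3) u₄ with hf'
  set σ := flipPerm (x 1) (x 2) u₂ (x 3) with hσ
  obtain ⟨-, -, -, h02, -⟩ := hF.basic_ne hf
  have hrot : ∀ a b, a ≠ x 1 → a ≠ x 2 → f' a b = σ a (f a (σ a b)) := fun a b h1 h2 => by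
    rw [hf', flipRotation, if_neg h1, if_neg h2]
  have hσ1 : ∀ a b, b ≠ x 1 → b ≠ x 2 → σ a b = b := fun a b h h' => by
    rw [hσ, flipPerm]
    split_ifs
    · exact Equiv.swap_apply_of_ne_of_ne h h'
    · rfl
  have hx0 : x k = x 0 := by simpa using hper 0
  have hx1 : x (k + 1) = x 1 := by simpa [add_comm] using hper 1
  have hn1 : ∀ i, 3 ≤ i → i ≤ k → x i ≠ x 1 := fun i h h' =>
    (hne 1 i (by omega) (by omega)).symm
  have hn2 : ∀ i, 3 ≤ i → i ≤ k → x i ≠ x 2 := fun i h h' =>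
    (hne 2 i (by omega) (by omega)).symm
  obtain ⟨y, hy, hy0, hy1⟩ := (hF.isCubicRotation hf).exists_isFaceWalk
    ((hF.flip_adj₁ hf (x 3)).2 (by simp))
  have key : ∀ i, i + 2 ≤ k → y (i + 1) = x (i + 3) ∧ (i ≠ 0 → y i = x (i + 2)) := by
    intro i
    induction i with
    | zero => exact fun _ => ⟨hy1, fun h => absurd rfl h⟩
    | succ i ih =>
      intro hi
      obtain ⟨ih1, ih2⟩ := ih (by omega)
      refine ⟨?_, fun _ => ih1⟩
      rw [← hy.step i, ih1, ← hf', hrot _ _ (hn1 _ (by omega) (by omega))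
        (hn2 _ (by omega) (by omega))]
      have hs := hx.step (i + 2)
      rcases Nat.eq_zero_or_pos i with rfl | hi0
      -- At x₃ the walk now arrives from x₁ in place of x₂, and the renaming undoes this.
      · have : σ (x 3) (x 1) = x 2 := by simp [hσ, flipPerm]
        rw [hy0, zero_add, this, show f (x 3) (x 2) = x 4 from hs,
          hσ1 _ _ (hn1 _ (by omega) (by omega)) (hn2 _ (by omega) (by omega))]
      · rw [ih2 (by omega), hσ1 _ (x (i + 2)) (hn1 _ (by omega) (by omega))
          (hn2 _ (by omega) (by omega)), show f (x (i + 3)) (x (i + 2)) = x (i + 4) from hs]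
        rcases Nat.lt_or_ge k (i + 4) with h | h
        -- At the last vertex x_k = x₀ = u₁ nothing is renamed, since u₁ differs from u₂ and u₃; the
        -- walk closes up at x₁.
        · have hσ0 : σ (x (i + 3)) = 1 := by
            rw [show i + 3 = k by omega, hx0, hσ, flipPerm, if_neg]
            rw [not_or]
            exact ⟨h02, hF.ne₁₃⟩
          rw [hσ0]
          rfl
        · exact hσ1 _ _ (hn1 _ (by omega) h) (hn2 _ (by omega) h)
  refine ⟨y, hy, fun i => ?_⟩
  have hy2 : y (k - 1) = x 1 := by
    have := (key (k - 2) (by omega)).1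
    rwa [show k - 2 + 1 = k - 1 by omega, show k - 2 + 3 = k + 1 by omega, hx1] at this
  have hy3 : y (k - 2) = x 0 := by
    have := (key (k - 2) (by omega)).2 (by omega)
    rwa [show k - 2 + 2 = k by omega, hx0] at this
  have hy4 : y (k - 1 + 1) = x 3 := by
    have := hy.step (k - 2)
    rw [show k - 2 + 1 = k - 1 by omega, hy2, hy3, show k - 2 + 2 = k - 1 + 1 by omega] at this
    rw [← this]
    simp [flipRotation]
  have := hy.eq_add (i := k - 1) (j := 0) (by rw [hy2, hy0]) (by rw [hy4, zero_add, hy1]) i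
  rwa [zero_add, add_comm] at this

/-- The graph `G` can be transformed into `K₄` by ΔY and contraction-elongation operations on
three-connected planar cubic graphs. -/
def IsReducible (G : SimpleGraph V) : Prop :=
  ∃ (n : ℕ) (W : ℕ → Type u) (H : ∀ i, SimpleGraph (W i)),
    Nonempty (H 0 ≃g G) ∧
    Nonempty (H n ≃g (⊤ : SimpleGraph (Fin 4))) ∧
    (∀ i ≤ n, Finite (W i) ∧ (H i).IsCubic ∧ (H i).IsThreeConnected ∧ (H i).IsPlanar) ∧
    (∀ i < n, (H i).IsDeltaY (H (i + 1)) ∨ (H i).IsContractionElongation (H (i + 1)))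

/-- Prepends `G` to a chain. The step is required for every copy `K` of `G'`, because the chain
starts at a graph only isomorphic to `G'`. -/
theorem IsReducible.of_step [Finite V] [Nonempty V] {f : V → V → V} (hf : G.IsPlanarCubicMap f)
    {V' : Type u} {G' : SimpleGraph V'} (h : G'.IsReducible)
    (hstep : ∀ {W : Type u} (K : SimpleGraph W), Nonempty (K ≃g G') →
      G.IsDeltaY K ∨ G.IsContractionElongation K) : G.IsReducible := by
  obtain ⟨n, W, H, h0, hn, hH, hs⟩ := h
  let W' : ℕ → Type u := fun i => Nat.casesOn i V W
  let H' : ∀ i, SimpleGraph (W' i) := fun i =>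
    Nat.casesOn (motive := fun i => SimpleGraph (W' i)) i G H
  refine ⟨n + 1, W', H', ⟨Iso.refl⟩, hn, ?_, ?_⟩
  · rintro (_ | i) hi
    · exact ⟨‹Finite V›, hf.rot.isCubic, hf.isThreeConnected, hf.isPlanar⟩
    · exact hH i (by omega)
  · rintro (_ | i) hi
    · exact hstep _ h0
    · exact hs i (by omega)

theorem IsPlanarCubicMap.isReducible_of_card_eq_four [Finite V] [Nonempty V] {f : V → V → V}
    (hf : G.IsPlanarCubicMap f) (hV : Nat.card V = 4) : G.IsReducible := by
  classical
  have := Fintype.ofFinite V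
  have htop : G = ⊤ := by
    ext v w
    rw [top_adj]
    refine ⟨fun h => h.ne, fun hvw => ?_⟩
    have hsub : G.neighborSet v ⊆ {v}ᶜ := fun t ht => (mem_neighborSet _ _ _ |>.1 ht).ne'
    have heq : G.neighborSet v = {v}ᶜ := by
      refine Set.eq_of_subset_of_ncard_le hsub ?_
      rw [hf.rot.isCubic v, Set.ncard_compl, Set.ncard_singleton, hV]
    rw [← mem_neighborSet, heq]
    exact hvw.symm
  refine ⟨0, fun _ => V, fun _ => G, ⟨Iso.refl⟩, ⟨⟨Finite.equivFinOfCardEq hV, ?_⟩⟩,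
    fun _ _ => ⟨‹Finite V›, hf.rot.isCubic, hf.isThreeConnected, hf.isPlanar⟩, by simp⟩
  intro v w
  simp [htop]

theorem IsPlanarCubicMap.isReducible_of_flip [Finite V] [Nonempty V] [DecidableEq V]
    {f : V → V → V} (hf : G.IsPlanarCubicMap f) {v₁ v₂ u₁ u₂ u₃ u₄ : V}
    (hF : G.IsFlipConfiguration f v₁ v₂ u₁ u₂ u₃ u₄)
    (h : (G.contractElongate v₁ v₂ u₂ u₃).IsReducible) : G.IsReducible := by
  refine h.of_step hf fun K hK => Or.inr ?_
  obtain ⟨R, hR, hcons⟩ := hf.exists_rotationSystem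
  exact ⟨R, hR, v₁, v₂, u₁, u₂, u₃, u₄,
    hcons ((hF.adj₁ hf.rot u₁).2 (by simp)).symm hF.rot₁, hcons hF.adj hF.rot₂,
    hcons ((hF.adj₂ hf.rot u₄).2 (by simp)).symm hF.rot₂'', hcons hF.adj.symm hF.rot₁', hK⟩

theorem IsPlanarCubicMap.isReducible_of_deltaY [Finite V] [Nonempty V] {f : V → V → V}
    (hf : G.IsPlanarCubicMap f) {a b c x y z : V} (hT : G.IsTriangularFace f a b c x y z)
    (h : (G.deltaY a b c).IsReducible) : G.IsReducible := by
  refine h.of_step hf fun K hK => Or.inl ?_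
  obtain ⟨R, hR, hcons⟩ := hf.exists_rotationSystem
  exact ⟨R, hR, a, b, c, hcons hT.adj_ab hT.rot_b, hcons hT.adj_bc hT.rot_c,
    hcons hT.adj_ca hT.rot_a, hK⟩

theorem card_deltaY_lt [Finite V] {a b c : V} (hab : a ≠ b) :
    Nat.card (Option {v : V // v ≠ a ∧ v ≠ b ∧ v ≠ c}) < Nat.card V := by
  classical
  have := Fintype.ofFinite V
  rw [Nat.card_eq_fintype_card, Nat.card_eq_fintype_card]
  refine Fintype.card_lt_of_surjective_not_injective (contractTriangle a b c) ?_ fun h => hab (h ?_)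
  · rintro (_ | p)
    · exact ⟨a, IsTriangularFace.contractTriangle_of_mem (by simp)⟩
    · exact ⟨p, IsTriangularFace.contractTriangle_of_ne p.2⟩
  · rw [IsTriangularFace.contractTriangle_of_mem (by simp),
      IsTriangularFace.contractTriangle_of_mem (by simp)]

/-- Lexicographic induction on the number of vertices and a period `k` of a face walk. The period
need not be minimal, so after ΔY any face with any period can be taken. -/
theorem IsPlanarCubicMap.isReducible_of_period (N : ℕ) : ∀ (k : ℕ) {V : Type u} [Finite V]
    {G : SimpleGraph V} {f : V → V → V} {x : ℕ → V}, Nat.card V = N → G.IsPlanarCubicMap f →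
    G.IsFaceWalk f x → 0 < k → (∀ i, x (i + k) = x i) → G.IsReducible := by
  classical
  induction N using Nat.strong_induction_on with
  | _ N ihN =>
  intro k
  induction k using Nat.strong_induction_on with
  | _ k ihk =>
  intro V _ G f x hV hf hx hk hper
  have hne : Nonempty V := ⟨x 0⟩
  have hcard := hf.rot.isCubic.three_lt_card (x 0)
  rcases (show 4 = Nat.card V ∨ 4 < Nat.card V by omega) with hV4 | hV4
  · exact hf.isReducible_of_card_eq_four hV4.symm
  by_cases hmin : ∀ i j, i < j → j < i + k → ¬ (x i = x j ∧ x (i + 1) = x (j + 1))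
  swap
  -- A dart repeated within the period gives a smaller period of the same face.
  · push Not at hmin
    obtain ⟨i, j, hij, hjk, h0, h1⟩ := hmin
    refine ihk (j - i) (by omega) hV hf (hx.shift i) (by omega) fun n => ?_
    rw [hx.eq_add h0 h1 n]
    congr 1
    omega
  have hdist : ∀ i j, i < j → j < i + k → x i ≠ x j := fun i j => hx.ne_of_lt hf hper hmin
  have h01 := (hx.adj 0).ne
  have h02 : x 2 ≠ x 0 := by
    rw [← hx.step 0]
    exact hf.rot.ne (hx.adj 0).symm
  rcases (show k = 1 ∨ k = 2 ∨ k = 3 ∨ 4 ≤ k by omega) with rfl | rfl | rfl | hk4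
  · exact absurd (hper 0).symm h01
  · exact absurd (hper 0) h02
  · have hT : G.IsTriangularFace f (x 0) (x 1) (x 2) (f (x 0) (x 1)) (f (x 1) (x 2))
        (f (x 2) (x 0)) := by
      refine ⟨hx.adj 0, hx.adj 1, ?_, ?_, hx.step 0, ?_, rfl, rfl, rfl⟩
      · rw [← hper 0]
        exact hx.adj 2
      · rw [← hper 0, ← hper 1]
        exact hx.step 2
      · rw [← hper 0]
        exact hx.step 1
    have hxy := hT.x_ne_y hf.rot hf.conn hV4
    have hyz := hT.rotate.x_ne_y hf.rot hf.conn hV4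
    have hzx := hT.rotate.rotate.x_ne_y hf.rot hf.conn hV4
    refine hf.isReducible_of_deltaY hT ?_
    have hf' := hT.isCubicRotation hf.rot hxy hyz hzx
    obtain ⟨w, hw⟩ := hf'.exists_adj none
    obtain ⟨y, hy, -, -⟩ := hf'.exists_isFaceWalk hw
    obtain ⟨k', hk', hper'⟩ := hy.exists_period hf'
    exact ihN _ (hV ▸ card_deltaY_lt hT.adj_ab.ne) k' rfl
      ⟨hf', hT.isAcyclicRotation hf.rot hxy hyz hzx hf.acyclic,
        hT.isThreeEdgeConnected hf.rot hxy hyz hzx hf.conn⟩ hy hk' hper'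
  -- Stated for an arbitrary walk so that it also applies to the walk shifted by one, that is, to
  -- the edge x₂x₃ when x₁x₂ is obstructed.
  · have hstep : ∀ x : ℕ → V, G.IsFaceWalk f x → (∀ i, x (i + k) = x i) →
        (∀ i j, i < j → j < i + k → x i ≠ x j) →
        (∀ T e, ¬ G.IsObstructingCut (x 1) (x 2) (x 0) (f (x 1) (x 2)) (x 3)
          (f (x 2) (x 3)) T e) → G.IsReducible := by
      intro x hx hper hdist hT
      have hF := hx.isFlipConfiguration hf (hdist 0 3 (by omega) (by omega))
        (hdist 1 4 (by omega) (by omega)) hT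
      refine hf.isReducible_of_flip hF ?_
      obtain ⟨y, hy, hpery⟩ := hx.exists_shorter hf.rot hk4 hper hdist hF
      exact ihk (k - 1) (by omega) hV ⟨hF.isCubicRotation hf.rot,
        hF.isAcyclicRotation hf.rot hf.acyclic, hF.isThreeEdgeConnected hf.rot hf.conn hT⟩ hy
        (by omega) hpery
    by_cases hT : ∃ T e, G.IsObstructingCut (x 1) (x 2) (x 0) (f (x 1) (x 2)) (x 3)
        (f (x 2) (x 3)) T e
    · obtain ⟨T, e, hT⟩ := hT
      refine hstep (fun i => x (1 + i)) (hx.shift 1) (fun i => by simpa only [add_assoc] using hper (1 + i))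
        (fun i j hij hjk => hdist _ _ (by omega) (by omega)) fun T' e' hT' => ?_
      exact hx.not_isObstructingCut_and hf (hdist 0 3 (by omega) (by omega)) hT hT'
    · push Not at hT
      exact hstep x hx hper hdist hT

end SimpleGraph

theorem lemma3p11 {V : Type u} [Finite V] (G : SimpleGraph V)
    (hreg : G.IsCubic) (hconn : G.IsThreeConnected) (hplanar : G.IsPlanar) :
    ∃ (n : ℕ) (W : ℕ → Type u) (H : ∀ i, SimpleGraph (W i)),
      Nonempty (H 0 ≃g G) ∧
      Nonempty (H n ≃g (⊤ : SimpleGraph (Fin 4))) ∧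
      (∀ i ≤ n, Finite (W i) ∧ (H i).IsCubic ∧ (H i).IsThreeConnected ∧ (H i).IsPlanar) ∧
      (∀ i < n, (H i).IsDeltaY (H (i + 1)) ∨ (H i).IsContractionElongation (H (i + 1))) := by
  obtain ⟨f, hf⟩ := SimpleGraph.exists_isPlanarCubicMap hreg hconn hplanar
  have hne : Nonempty V := (Nat.card_pos_iff.1 (lt_trans (by norm_num) hconn.1)).1
  obtain ⟨w, hw⟩ := hf.rot.exists_adj hne.some
  obtain ⟨x, hx, -, -⟩ := hf.rot.exists_isFaceWalk hw
  obtain ⟨k, hk, hper⟩ := hx.exists_period hf.rot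
  exact hf.isReducible_of_period _ k rfl hx hk hper
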